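/- Let $n\ge 0$ and let $F=(F_1,\dots,F_{2n})$ and $B$ be $C^\infty$ functions of $(z,t)\in\mathbb R^{2n}\times\mathbb R$, with values in $\mathbb R^{2n}$ and $\mathbb R$. Put $K_{ij}(z,t)=\frac{\partial F_j}{\partial z_i}-\frac{\partial F_i}{\partial z_j}$, assume $\det K(z,t)\ne 0$ everywhere, and consider the nonautonomous Birkhoffian system $$K(z,t)\,\frac{dz}{dt}=\nabla_z B(z,t)+\frac{\partial F}{\partial t}(z,t).$$ Let $\alpha(t,t_0):(\hat z,z)\mapsto(\hat w,w)=(\alpha_1(\hat z,z,t,t_0),\alpha_2(\hat z,z,t,t_0))$, $t,t_0\in\mathbb R$, be diffeomorphisms of $\mathbb R^{4n}$ which, together with their inverses, depend smoothly on all variables, and whose Jacobian $\alpha_*=\begin{pmatrix}A_\alpha&B_\alpha\\C_\alpha&D_\alpha\end{pmatrix}$ satisfies $$\alpha_*^{T}\begin{pmatrix}0&I_{2n}\\-I_{2n}&0\end{pmatrix}\alpha_*=\begin{pmatrix}K(\hat z,t)&0\\0&-K(z,t_0)\end{pmatrix}.$$ For a linear map $P$ of $\mathbb R^{2n}$ let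 $$\mathcal A(\hat w,w,P,t,t_0)=(A_\alpha-PC_\alpha)\,K^{-1}\Big(\nabla B+\frac{\partial F}{\partial t}\Big)(\hat z,t)+\frac{\partial\alpha_1}{\partial t}-P\,\frac{\partial\alpha_2}{\partial t},$$ where $(\hat z,z)=\alpha(t,t_0)^{-1}(\hat w,w)$ and $A_\alpha,C_\alpha,\partial_t\alpha_1,\partial_t\alpha_2$ are taken at $(\hat z,z,t,t_0)$. Assume that $\mathcal A$ is analytic. Let $(z_0,t_0)$ satisfy the transversality condition $|C_\alpha(z_0,z_0,t_0,t_0)+D_\alpha(z_0,z_0,t_0,t_0)|\ne 0$, and put $w_0=\alpha_2(z_0,z_0,t_0,t_0)$. Then there is a map $\phi_w^{(0)}(w,s)$ with $\alpha_1(z,z,s,s)=\phi_w^{(0)}(\alpha_2(z,z,s,s),s)$ for all $(z,s)$ near $(z_0,t_0)$. For any such map, define recursively $$\phi_w^{(k+1)}(w,s)=\frac1{(k+1)!}\,\frac{d^k}{dt^k}\Big|_{t=s}\mathcal A\Big(\sum_{i\le k}(t-s)^i\phi_w^{(i)}(w,s),\,w,\,\sum_{i\le k}(t-s)^i\frac{\partial\phi_w^{(i)}}{\partial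 w}(w,s),\,t,\,s\Big),\qquad k\ge 0,$$ and, for $m=1,2,\dots$, let $\psi_w^{(m)}(w,t,s)=\sum_{i=0}^m(t-s)^i\phi_w^{(i)}(w,s)$. Then for every $m\ge1$: (a) there is a scalar function $\psi^{(m)}$ whose gradient in $w$ is $\psi_w^{(m)}(w,t,s)$ for all $(w,t,s)$ near $(w_0,t_0,t_0)$; (b) there are open neighborhoods $U,V$ of $z_0$, numbers $\delta,\tau_0>0$ and $C$, and a map $g$ such that for all $t_k$ with $|t_k-t_0|<\delta$, all $0<\tau<\tau_0$ and $t_{k+1}=t_k+\tau$ the following hold. 1. For every $z^k\in U$, $z^{k+1}=g(z^k,t_{k+1},t_k)$ is the unique solution in $V$ of $$\alpha_1(z^{k+1},z^k,t_{k+1},t_k)=\psi_w^{(m)}\big(\alpha_2(z^{k+1},z^k,t_{k+1},t_k),t_{k+1},t_k\big).$$ 2. The map $g(\cdot,t_{k+1},t_k)$ is differentiable and $K(z,t)$-symplectic on $U$: $\left(\frac{\partial g}{\partial z}\right)^{T}K(g(z,t_{k+1},t_k),t_{k+1})\,\frac{\partial g}{\partial z}=K(z,t_k)$. 3. The scheme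 has $m$-th order accuracy: for every $z\in U$ the system has a solution $y$ on $[t_k,t_{k+1}]$ with $y(t_k)=z$, and every such solution satisfies $\|g(z,t_{k+1},t_k)-y(t_{k+1})\|\le C\,\tau^{m+1}$. -/

import Mathlib

open Filter Topology
open scoped ContDiff Nat

noncomputable section

namespace Birkhoff

/-- The phase space `ℝ²ⁿ`. -/
abbrev Phase (n : ℕ) : Type := Fin (2 * n) → ℝ

/-- The Jacobian matrix `(∂gᵢ/∂zⱼ)ᵢⱼ` of a map of the phase space. -/
def jacobian {n : ℕ} (g : Phase n → Phase n) (z : Phase n) :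
    Matrix (Fin (2 * n)) (Fin (2 * n)) ℝ :=
  Matrix.of fun i j => fderiv ℝ g z (Pi.single j 1) i

/-- The gradient `(∂b/∂zᵢ)ᵢ` of a scalar function. -/
def grad {n : ℕ} (b : Phase n → ℝ) (z : Phase n) : Phase n :=
  fun i => fderiv ℝ b z (Pi.single i 1)

/-- A (nonautonomous) Birkhoffian system with smooth Birkhoffian functions `F₁, …, F₂ₙ` and
smooth Birkhoffian `B`, all depending on `(z, t)`. -/
structure System (n : ℕ) where
  /-- The Birkhoffian functions. -/
  F : Phase n → ℝ → Phase n
  /-- The Birkhoffian. -/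
  B : Phase n → ℝ → ℝ
  smooth_F : ContDiff ℝ ∞ fun p : Phase n × ℝ => F p.1 p.2
  smooth_B : ContDiff ℝ ∞ fun p : Phase n × ℝ => B p.1 p.2

/-- The matrix `Kᵢⱼ(z,t) = ∂Fⱼ/∂zᵢ - ∂Fᵢ/∂zⱼ`. -/
def System.K {n : ℕ} (S : System n) (z : Phase n) (t : ℝ) :
    Matrix (Fin (2 * n)) (Fin (2 * n)) ℝ :=
  Matrix.of fun i j =>
    jacobian (fun z' => S.F z' t) z j i - jacobian (fun z' => S.F z' t) z i j

/-- The system is regular: `det K` vanishes nowhere. -/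
def System.Regular {n : ℕ} (S : System n) : Prop :=
  ∀ z t, (S.K z t).det ≠ 0

/-- The covector `∇B(z,t) + ∂F/∂t(z,t)`. -/
def System.force {n : ℕ} (S : System n) (z : Phase n) (t : ℝ) : Phase n :=
  grad (fun z' => S.B z' t) z + deriv (fun t' => S.F z t') t

/-- `y` solves Birkhoff's equations `K(y,t) y' = ∇B(y,t) + ∂F/∂t(y,t)` on `[a, b]`. -/
def System.IsSolutionOn {n : ℕ} (S : System n) (y : ℝ → Phase n) (a b : ℝ) : Prop :=
  ∀ t ∈ Set.Icc a b, ∃ v : Phase n, HasDerivWithinAt y v (Set.Icc a b) t ∧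
    (S.K (y t) t).mulVec v = S.force (y t) t

/-- The map `g`, which takes time `s` to time `t`, is differentiable and `K(z,t)`-symplectic on
`U`: `(∂g/∂z)ᵀ K(g(z),t) (∂g/∂z) = K(z,s)`. -/
def System.IsSymplecticOn {n : ℕ} (S : System n) (g : Phase n → Phase n) (t s : ℝ)
    (U : Set (Phase n)) : Prop :=
  ∀ z ∈ U, DifferentiableAt ℝ g z ∧
    (jacobian g z).transpose * S.K (g z) t * jacobian g z = S.K z s

/-- A smooth family `α(t,t₀) : (ẑ,z) ↦ (ŵ,w)` of diffeomorphisms of `ℝ⁴ⁿ = ℝ²ⁿ × ℝ²ⁿ`. -/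
structure Transformation (n : ℕ) where
  /-- `α(t,t₀)`, together with its inverse. -/
  map : ℝ → ℝ → (Phase n × Phase n) ≃ (Phase n × Phase n)
  smooth_map : ContDiff ℝ ∞ fun p : (Phase n × Phase n) × ℝ × ℝ => map p.2.1 p.2.2 p.1
  smooth_symm : ContDiff ℝ ∞ fun p : (Phase n × Phase n) × ℝ × ℝ => (map p.2.1 p.2.2).symm p.1

namespace Transformation

variable {n : ℕ}

/-- The first component `ŵ = α₁(ẑ,z,t,t₀)`. -/
def one (α : Transformation n) (zh z : Phase n) (t t₀ : ℝ) : Phase n := (α.map t t₀ (zh, z)).1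

/-- The second component `w = α₂(ẑ,z,t,t₀)`. -/
def two (α : Transformation n) (zh z : Phase n) (t t₀ : ℝ) : Phase n := (α.map t t₀ (zh, z)).2

/-- The block `A_α = ∂α₁/∂ẑ` of the Jacobian of `α`. -/
def A (α : Transformation n) (zh z : Phase n) (t t₀ : ℝ) :=
  jacobian (fun x => α.one x z t t₀) zh

/-- The block `B_α = ∂α₁/∂z`. -/
def B (α : Transformation n) (zh z : Phase n) (t t₀ : ℝ) :=
  jacobian (fun x => α.one zh x t t₀) z

/-- The block `C_α = ∂α₂/∂ẑ`. -/
def C (α : Transformation n) (zh z : Phase n) (t t₀ : ℝ) :=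
  jacobian (fun x => α.two x z t t₀) zh

/-- The block `D_α = ∂α₂/∂z`. -/
def D (α : Transformation n) (zh z : Phase n) (t t₀ : ℝ) :=
  jacobian (fun x => α.two zh x t t₀) z

/-- The Jacobian matrix `α_*` of `α(t,t₀)` at `(ẑ,z)`. -/
def jac (α : Transformation n) (zh z : Phase n) (t t₀ : ℝ) :
    Matrix (Fin (2 * n) ⊕ Fin (2 * n)) (Fin (2 * n) ⊕ Fin (2 * n)) ℝ :=
  Matrix.fromBlocks (α.A zh z t t₀) (α.B zh z t t₀) (α.C zh z t t₀) (α.D zh z t t₀)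

end Transformation

/-- The matrix `J₄ₙ`. -/
def J4 (n : ℕ) : Matrix (Fin (2 * n) ⊕ Fin (2 * n)) (Fin (2 * n) ⊕ Fin (2 * n)) ℝ :=
  Matrix.fromBlocks 0 1 (-1) 0

/-- `α_*ᵀ J₄ₙ α_* = diag(K(ẑ,t), -K(z,t₀))`: the transformation carries Lagrangian submanifolds
for the right-hand side to `J₄ₙ`-Lagrangian submanifolds. -/
def Transformation.IsAdapted {n : ℕ} (α : Transformation n) (S : System n) : Prop :=
  ∀ zh z t t₀, (α.jac zh z t t₀).transpose * J4 n * α.jac zh z t t₀ =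
    Matrix.fromBlocks (S.K zh t) 0 0 (-S.K z t₀)

/-- The transversality condition `|C_α(z,z,t₀,t₀) + D_α(z,z,t₀,t₀)| ≠ 0` at `(z,t₀)`. -/
def Transformation.IsTransversal {n : ℕ} (α : Transformation n) (z : Phase n) (t₀ : ℝ) : Prop :=
  (α.C z z t₀ t₀ + α.D z z t₀ t₀).det ≠ 0

/-- The right-hand side `(A_α - P C_α) K⁻¹(∇B + ∂F/∂t)(ẑ,t) + ∂α₁/∂t - P ∂α₂/∂t`, at
`(ẑ,z,t,t₀)`, of the equation of the generating function; `P` stands for `∂ŵ/∂w`. -/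
def rhsBar {n : ℕ} (S : System n) (α : Transformation n) (zh z : Phase n)
    (P : Phase n →L[ℝ] Phase n) (t t₀ : ℝ) : Phase n :=
  let X : Phase n := (S.K zh t)⁻¹.mulVec (S.force zh t)
  (α.A zh z t t₀).mulVec X - P ((α.C zh z t t₀).mulVec X)
    + deriv (fun t' => α.one zh z t' t₀) t - P (deriv (fun t' => α.two zh z t' t₀) t)

/-- The right-hand side `𝒜(ŵ,w,P,t,t₀)`, in the variables `(ŵ,w) = α(t,t₀)(ẑ,z)`. -/
def rhs {n : ℕ} (S : System n) (α : Transformation n) (wh w : Phase n)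
    (P : Phase n →L[ℝ] Phase n) (t t₀ : ℝ) : Phase n :=
  rhsBar S α ((α.map t t₀).symm (wh, w)).1 ((α.map t t₀).symm (wh, w)).2 P t t₀

/-- `φ₀(w,s)` is, for `(w,s)` near `(α₂(z₀,z₀,t₀,t₀), t₀)`, the value at `t = s` of the gradient
map `f(w,t,s)` belonging to the phase flow. As the flow from time `s` to time `s` is the
identity, this says `α₁(z,z,s,s) = φ₀(α₂(z,z,s,s), s)` for all `(z,s)` near `(z₀,t₀)`. -/
def IsInitialGradientMap {n : ℕ} (α : Transformation n) (z₀ : Phase n) (t₀ : ℝ)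
    (φ₀ : Phase n → ℝ → Phase n) : Prop :=
  ∀ᶠ p : Phase n × ℝ in 𝓝 (z₀, t₀), α.one p.1 p.1 p.2 p.2 = φ₀ (α.two p.1 p.1 p.2 p.2) p.2

/-- The coefficients `φ_w⁽ᵏ⁾(w,s)`, where `s` is the initial time:
`φ_w⁽⁰⁾ = φ₀` and `φ_w⁽ᵏ⁺¹⁾ = (1/(k+1)!) D_tᵏ 𝒜(φ_w, w, φ_ww, t, s)` at `t = s`. The total
derivative is that along `φ_w = ∑ᵢ (t-s)ⁱ φ_w⁽ⁱ⁾`, `φ_ww = ∑ᵢ (t-s)ⁱ φ_ww⁽ⁱ⁾`; only the terms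
with `i ≤ k` contribute to it at `t = s`. -/
def coeff {n : ℕ} (S : System n) (α : Transformation n) (φ₀ : Phase n → ℝ → Phase n) :
    ℕ → Phase n → ℝ → Phase n
  | 0 => φ₀
  | k + 1 => fun w s =>
      (((k + 1)! : ℕ) : ℝ)⁻¹ • iteratedDeriv k (fun t =>
        rhs S α (∑ i : Fin (k + 1), (t - s) ^ (i : ℕ) • coeff S α φ₀ i w s) w
          (∑ i : Fin (k + 1), (t - s) ^ (i : ℕ) • fderiv ℝ (fun w' => coeff S α φ₀ i w' s) w)
          t s) s
termination_by k => k
decreasing_by all_goals exact i.2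

/-- The truncated series `ψ_w⁽ᵐ⁾(w,t,s) = ∑_{i ≤ m} (t-s)ⁱ φ_w⁽ⁱ⁾(w,s)`. -/
def truncated {n : ℕ} (S : System n) (α : Transformation n) (φ₀ : Phase n → ℝ → Phase n)
    (m : ℕ) (w : Phase n) (t s : ℝ) : Phase n :=
  ∑ i ∈ Finset.range (m + 1), (t - s) ^ i • coeff S α φ₀ i w s

/-- The implicit relation `α₁(z',z,t',t) = ψ_w⁽ᵐ⁾(α₂(z',z,t',t), t', t)` between two consecutive
states `z` (at time `t`) and `z'` (at time `t'`). -/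
def SchemeRelation {n : ℕ} (S : System n) (α : Transformation n) (φ₀ : Phase n → ℝ → Phase n)
    (m : ℕ) (z' z : Phase n) (t' t : ℝ) : Prop :=
  α.one z' z t' t = truncated S α φ₀ m (α.two z' z t' t) t' t

end Birkhoff

end

/-!
The scheme is accurate and symplectic because the coefficients `φ_w⁽ᵏ⁾` are the Taylor coefficients in
`t` of the gradient map of the phase flow. The proof below does not construct the flow or its
generating function; it works with the truncated series alone. Everything is smooth near the base
point, time is written `t = s + τ`, and errors are measured by their order of vanishing at `τ = 0`.

* By construction the truncated series solves the equation `∂f/∂t = 𝒜(f, w, ∂f/∂w, t, s)` up to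
  `O(τ^m)` (`residual_isBigO`), since only the terms of order at most `i` of the series enter the
  `i`-th derivative of the right-hand side at `τ = 0`.
* By transversality and the implicit function theorem the implicit relation has a smooth solution
  `g(z, s, τ)` with `g(z, s, 0) = z` (`exists_stepMap`). Differentiating the relation in `τ` turns the
  residual of the series into the defect of `g` as a solution of Birkhoff's equations:
  `∂g/∂τ = K⁻¹(∇B + ∂F/∂t)(g, s + τ) + O(τ^m)` (`IsStepMap.defect_isBigO`). Grönwall's inequality
  then gives the accuracy (`exists_solution_and_defect_bound`).
* The matrix `K` is the exterior derivative of the one-form `F · dz`. By Cartan's formula the pull-back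
  of this one-form along `g` has an exact `τ`-derivative up to a contraction with the defect, so that
  `g` preserves the two-form up to `O(τ^(m+1))` (`System.isBigO_form_pullback_sub`). A derivative in
  `z` of the defect occurs here; it is again `O(τ^m)` because for smooth maps the order of vanishing is
  a matter of Taylor coefficients (`SmoothNear.isBigO_fderiv`).
* As `α` carries `K ⊕ (-K)` to the canonical form, the antisymmetric part of the derivative in `w` of
  the truncated series is the failure of `g` to be symplectic, in suitable coordinates
  (`IsStepMap.antisymm_seriesDeriv_eq`). It is `O(τ^(m+1))` and a polynomial of degree at most `m` in
  `τ`, hence zero (`IsStepMap.seriesDeriv_symm`). So the truncated series is a gradient, by the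
  Poincaré lemma, and by the same identity `g` is exactly symplectic.

The analyticity of `𝒜` enters only through the smoothness of `𝒜`.
-/

noncomputable section

namespace Birkhoff

/-! ### Germs of smooth maps and vanishing to finite order -/

section Germs

variable {E F G : Type*} [NormedAddCommGroup E] [NormedSpace ℝ E]
  [NormedAddCommGroup F] [NormedSpace ℝ F] [NormedAddCommGroup G] [NormedSpace ℝ G]

/-- `f` is `C^∞` in a neighbourhood of `x`. In Mathlib `ContDiffAt ℝ ∞ f x` only says that `f` is
`C^k` in a neighbourhood of `x` which may depend on `k`. -/
def SmoothNear (f : E → F) (x : E) : Prop := ∀ᶠ y in 𝓝 x, ContDiffAt ℝ ∞ f y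

namespace SmoothNear

protected theorem contDiffAt {f : E → F} {x : E} (h : SmoothNear f x) : ContDiffAt ℝ ∞ f x := h.self_of_nhds

protected theorem differentiableAt {f : E → F} {x : E} (h : SmoothNear f x) : DifferentiableAt ℝ f x :=
  h.contDiffAt.differentiableAt (by simp)

protected theorem continuousAt {f : E → F} {x : E} (h : SmoothNear f x) : ContinuousAt f x :=
  h.contDiffAt.continuousAt

protected theorem eventually {f : E → F} {x : E} (h : SmoothNear f x) : ∀ᶠ y in 𝓝 x, SmoothNear f y :=
  eventually_eventually_nhds.2 h

protected theorem congr {f g : E → F} {x : E} (h : SmoothNear f x) (hfg : g =ᶠ[𝓝 x] f) : SmoothNear g x := by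
  filter_upwards [h, hfg.eventuallyEq_nhds] with y h1 h2 using h1.congr_of_eventuallyEq h2

protected theorem comp {g : F → G} {f : E → F} {x : E} (hg : SmoothNear g (f x)) (hf : SmoothNear f x) :
    SmoothNear (fun y => g (f y)) x := by
  filter_upwards [hf, hf.continuousAt.eventually hg] with y h1 h2 using h2.comp y h1

protected theorem prodMk {f : E → F} {g : E → G} {x : E} (hf : SmoothNear f x) (hg : SmoothNear g x) :
    SmoothNear (fun y => (f y, g y)) x := by
  filter_upwards [hf, hg] with y h1 h2 using h1.prodMk h2

protected theorem sub {f g : E → F} {x : E} (hf : SmoothNear f x) (hg : SmoothNear g x) :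
    SmoothNear (fun y => f y - g y) x := by
  filter_upwards [hf, hg] with y h1 h2 using h1.sub h2

protected theorem mul {f g : E → ℝ} {x : E} (hf : SmoothNear f x) (hg : SmoothNear g x) :
    SmoothNear (fun y => f y * g y) x := by
  filter_upwards [hf, hg] with y h1 h2 using h1.mul h2

protected theorem smul {f : E → ℝ} {g : E → F} {x : E} (hf : SmoothNear f x) (hg : SmoothNear g x) :
    SmoothNear (fun y => f y • g y) x := by
  filter_upwards [hf, hg] with y h1 h2 using h1.smul h2

protected theorem clm_apply {f : E → F →L[ℝ] G} {g : E → F} {x : E} (hf : SmoothNear f x)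
    (hg : SmoothNear g x) : SmoothNear (fun y => f y (g y)) x := by
  filter_upwards [hf, hg] with y h1 h2 using h1.clm_apply h2

protected theorem sum {ι : Type*} {f : ι → E → F} {s : Finset ι} {x : E}
    (hf : ∀ i ∈ s, SmoothNear (f i) x) : SmoothNear (fun y => ∑ i ∈ s, f i y) x := by
  have := (Filter.eventually_all_finset s).2 hf
  filter_upwards [this] with y h using ContDiffAt.sum h

protected theorem apply {ι : Type*} [Fintype ι] {f : E → ι → F} {x : E}
    (hf : SmoothNear f x) (i : ι) : SmoothNear (fun y => f y i) x := by
  filter_upwards [hf] with y h using contDiffAt_pi.1 h i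

protected theorem fderiv {f : E → F} {x : E} (h : SmoothNear f x) : SmoothNear (fderiv ℝ f) x := by
  filter_upwards [h] with y hy using hy.fderiv_right (by simp)

/-- The derivative with respect to one group of variables is smooth in all variables. -/
protected theorem fderiv_comp {f : E → F → G} {a : E → F} {x : E}
    (h : SmoothNear (fun p : E × F => f p.1 p.2) (x, a x)) (ha : SmoothNear a x) :
    SmoothNear (fun y => fderiv ℝ (f y) (a y)) x := by
  have h1 : Tendsto (fun y => (y, a y)) (𝓝 x) (𝓝 (x, a x)) :=
    (continuousAt_id.prodMk ha.continuousAt)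
  filter_upwards [ha, h1.eventually h] with y hy hy'
  exact ContDiffAt.fderiv (f := f) hy' hy (by simp)

end SmoothNear

theorem _root_.ContDiff.smoothNear {f : E → F} (h : ContDiff ℝ ∞ f) (x : E) : SmoothNear f x :=
  Eventually.of_forall fun _ => h.contDiffAt

/-- Directional derivatives of a smooth map commute. -/
theorem SmoothNear.fderiv_fderiv_comm {f : E → F} {x : E} (h : SmoothNear f x) (u v : E) :
    fderiv ℝ (fun y => fderiv ℝ f y v) x u = fderiv ℝ (fun y => fderiv ℝ f y u) x v := by
  have hd : DifferentiableAt ℝ (fderiv ℝ f) x := h.fderiv.differentiableAt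
  rw [fderiv_clm_apply hd (differentiableAt_const _), fderiv_clm_apply hd (differentiableAt_const _)]
  have := h.contDiffAt.isSymmSndFDerivAt (by simpa using (WithTop.coe_le_coe.2 le_top : ((2 : ℕ∞) : WithTop ℕ∞) ≤ ∞))
  simpa using this u v

/-- The derivative of `r(p, τ)` with respect to `τ`, as a function of `(p, τ)`. -/
def timeDeriv (r : E × ℝ → F) (x : E × ℝ) : F := deriv (fun τ => r (x.1, τ)) x.2

theorem timeDeriv_eq {r : E × ℝ → F} {x : E × ℝ} (h : DifferentiableAt ℝ r x) :
    timeDeriv r x = fderiv ℝ r x (0, 1) := by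
  have h1 : HasDerivAt (fun τ : ℝ => (x.1, τ)) ((0 : E), (1 : ℝ)) x.2 :=
    (hasDerivAt_const _ _).prodMk (hasDerivAt_id _)
  exact (h.hasFDerivAt.comp_hasDerivAt x.2 (f := fun τ => (x.1, τ)) h1).deriv

theorem SmoothNear.timeDeriv_eventuallyEq {r : E × ℝ → F} {x : E × ℝ} (h : SmoothNear r x) :
    timeDeriv r =ᶠ[𝓝 x] fun y => fderiv ℝ r y (0, 1) := by
  filter_upwards [h.eventually] with y hy using timeDeriv_eq hy.differentiableAt

protected theorem SmoothNear.timeDeriv {r : E × ℝ → F} {x : E × ℝ} (h : SmoothNear r x) :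
    SmoothNear (timeDeriv r) x :=
  SmoothNear.congr (h.fderiv.clm_apply (contDiff_const.smoothNear _)) h.timeDeriv_eventuallyEq

protected theorem SmoothNear.iteratedDeriv {r : E × ℝ → F} {x : E × ℝ} (h : SmoothNear r x) (k : ℕ) :
    SmoothNear (fun y : E × ℝ => iteratedDeriv k (fun τ => r (y.1, τ)) y.2) x := by
  induction k generalizing r with
  | zero => simpa using h
  | succ k ih =>
    simp only [iteratedDeriv_succ']
    exact ih h.timeDeriv

theorem tendsto_prodMk_zero {X : Type*} [TopologicalSpace X] (p₀ : X) : Tendsto (fun p : X => (p, (0 : ℝ))) (𝓝 p₀) (𝓝 (p₀, 0)) :=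
  (Continuous.prodMk_left (0 : ℝ)).tendsto p₀

/-- Integrating in `τ` raises the order of vanishing at `τ = 0` by one. -/
theorem isBigO_pow_succ_of_timeDeriv {r : E × ℝ → F} {p₀ : E} {N : ℕ}
    (hr : SmoothNear r (p₀, 0)) (h0 : ∀ᶠ p in 𝓝 p₀, r (p, 0) = 0)
    (h' : timeDeriv r =O[𝓝 (p₀, 0)] fun x => x.2 ^ N) :
    r =O[𝓝 (p₀, 0)] fun x => x.2 ^ (N + 1) := by
  obtain ⟨C, hC⟩ := h'.bound
  have h0' : ∀ᶠ x : E × ℝ in 𝓝 (p₀, 0), r (x.1, 0) = 0 := (continuousAt_fst (p := (p₀, (0 : ℝ)))).eventually h0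
  obtain ⟨ε, hε, hball⟩ := Metric.eventually_nhds_iff_ball.1 (hC.and (h0'.and hr.eventually))
  refine Asymptotics.IsBigO.of_bound C ?_
  filter_upwards [Metric.ball_mem_nhds _ hε] with x hx
  have hmem : ∀ σ ∈ Set.uIcc 0 x.2, (x.1, σ) ∈ Metric.ball (p₀, (0 : ℝ)) ε ∧ |σ| ≤ |x.2| := by
    intro σ hσ
    have h1 : |σ| ≤ |x.2| := by
      have := Set.abs_sub_left_of_mem_uIcc hσ
      simpa using this
    refine ⟨?_, h1⟩
    rw [Metric.mem_ball, Prod.dist_eq, max_lt_iff] at hx ⊢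
    refine ⟨hx.1, ?_⟩
    have := hx.2
    simp only [Real.dist_eq, sub_zero] at this ⊢
    exact h1.trans_lt this
  have key := Convex.norm_image_sub_le_of_norm_deriv_le (f := fun τ => r (x.1, τ))
    (C := C * ‖x.2 ^ N‖) (s := Set.uIcc 0 x.2) (x := 0) (y := x.2) ?_ ?_ (convex_uIcc _ _)
    Set.left_mem_uIcc Set.right_mem_uIcc
  · rw [(hball x hx).2.1, sub_zero, sub_zero] at key
    rw [pow_succ, norm_mul, ← mul_assoc]
    exact key
  · intro σ hσ
    have hd : DifferentiableAt ℝ r (x.1, σ) := (hball _ (hmem σ hσ).1).2.2.differentiableAt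
    exact hd.comp σ (f := fun τ => (x.1, τ)) (by fun_prop)
  · intro σ hσ
    have h1 := (hball _ (hmem σ hσ).1).1
    have hC0 : 0 ≤ C ∨ x.2 ^ N = 0 := by
      by_contra! hcon
      have := (hball x hx).1
      have h2 : C * ‖x.2 ^ N‖ < 0 := mul_neg_of_neg_of_pos hcon.1 (norm_pos_iff.2 hcon.2)
      linarith [norm_nonneg (timeDeriv r x)]
    refine h1.trans ?_
    have h3 : ‖σ ^ N‖ ≤ ‖x.2 ^ N‖ := by
      rw [norm_pow, norm_pow]
      exact pow_le_pow_left₀ (norm_nonneg _) (hmem σ hσ).2 _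
    rcases hC0 with hC0 | hC0
    · exact mul_le_mul_of_nonneg_left h3 hC0
    · have h4 : ‖σ ^ N‖ = 0 := le_antisymm (by simpa [hC0] using h3) (norm_nonneg _)
      rw [h4, hC0]; simp

/-- A smooth map whose `τ`-derivatives of order less than `N` vanish at `τ = 0` is `O(τ^N)`, locally
uniformly in the other variables. -/
theorem isBigO_pow_of_iteratedDeriv {r : E × ℝ → F} {p₀ : E} {N : ℕ}
    (hr : SmoothNear r (p₀, 0))
    (h0 : ∀ i < N, ∀ᶠ p in 𝓝 p₀, iteratedDeriv i (fun τ => r (p, τ)) 0 = 0) :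
    r =O[𝓝 (p₀, 0)] fun x => x.2 ^ N := by
  induction N generalizing r with
  | zero =>
    simp only [pow_zero]
    exact hr.continuousAt.isBigO_one ℝ
  | succ N ih =>
    refine isBigO_pow_succ_of_timeDeriv hr (by simpa using h0 0 (by simp)) (ih hr.timeDeriv ?_)
    intro i hi
    have := h0 (i + 1) (by omega)
    simp only [iteratedDeriv_succ'] at this
    exact this

/-- A polynomial of degree at most `m` which is `O(τ^(m+1))` vanishes. -/
theorem eq_zero_of_sum_pow_smul_isBigO {m : ℕ} {a : ℕ → F}
    (h : (fun τ : ℝ => ∑ i ∈ Finset.range (m + 1), τ ^ i • a i) =O[𝓝 0] fun τ => τ ^ (m + 1)) :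
    ∀ i ≤ m, a i = 0 := by
  induction m generalizing a with
  | zero =>
    intro i hi
    obtain rfl : i = 0 := by omega
    simp only [zero_add, Finset.range_one, Finset.sum_singleton, pow_zero, one_smul, pow_one] at h
    have h1 : Tendsto (fun _ : ℝ => a 0) (𝓝 0) (𝓝 0) := h.trans_tendsto tendsto_id
    exact tendsto_nhds_unique tendsto_const_nhds h1
  | succ m ih =>
    have h00 : a 0 = 0 := by
      have h1 : Tendsto (fun τ : ℝ => ∑ i ∈ Finset.range (m + 1 + 1), τ ^ i • a i) (𝓝 0) (𝓝 0) := by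
        refine h.trans_tendsto ?_
        have : Continuous fun τ : ℝ => τ ^ (m + 1 + 1) := by fun_prop
        simpa using this.tendsto 0
      have h2 : Continuous fun τ : ℝ => ∑ i ∈ Finset.range (m + 1 + 1), τ ^ i • a i := by fun_prop
      have h3 := tendsto_nhds_unique (h2.tendsto 0) h1
      rw [Finset.sum_range_succ'] at h3
      simpa using h3
    have h1 : (fun τ : ℝ => ∑ i ∈ Finset.range (m + 1), τ ^ i • a (i + 1)) =O[𝓝[≠] 0]
        fun τ => τ ^ (m + 1) := by
      have h2 : (fun τ : ℝ => τ⁻¹ • ∑ i ∈ Finset.range (m + 1 + 1), τ ^ i • a i) =O[𝓝[≠] 0]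
          fun τ => τ⁻¹ • τ ^ (m + 1 + 1) :=
        (Asymptotics.isBigO_refl _ _).smul (h.mono nhdsWithin_le_nhds)
      refine h2.congr' ?_ ?_
      · filter_upwards [self_mem_nhdsWithin] with τ hτ
        rw [Finset.sum_range_succ', h00, smul_zero, add_zero, Finset.smul_sum]
        refine Finset.sum_congr rfl fun i _ => ?_
        rw [smul_smul, pow_succ', ← mul_assoc, inv_mul_cancel₀ hτ, one_mul]
      · filter_upwards [self_mem_nhdsWithin] with τ hτ
        rw [smul_eq_mul, pow_succ' _ (m + 1), ← mul_assoc, inv_mul_cancel₀ hτ, one_mul]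
    have h2 : (fun τ : ℝ => ∑ i ∈ Finset.range (m + 1), τ ^ i • a (i + 1)) =O[𝓝 0]
        fun τ => τ ^ (m + 1) := by
      -- the bound extends from the punctured neighbourhood by continuity
      obtain ⟨C, hC⟩ := h1.bound
      refine Asymptotics.IsBigO.of_bound C ?_
      rw [eventually_nhdsWithin_iff] at hC
      have hcl : Tendsto (fun τ : ℝ => ‖∑ i ∈ Finset.range (m + 1), τ ^ i • a (i + 1)‖)
          (𝓝[≠] 0) (𝓝 ‖∑ i ∈ Finset.range (m + 1), (0 : ℝ) ^ i • a (i + 1)‖) := by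
        have : Continuous fun τ : ℝ => ‖∑ i ∈ Finset.range (m + 1), τ ^ i • a (i + 1)‖ := by
          fun_prop
        exact (this.tendsto 0).mono_left nhdsWithin_le_nhds
      have hcr : Tendsto (fun τ : ℝ => C * ‖τ ^ (m + 1)‖) (𝓝[≠] 0)
          (𝓝 (C * ‖(0 : ℝ) ^ (m + 1)‖)) := by
        have : Continuous fun τ : ℝ => C * ‖τ ^ (m + 1)‖ := by fun_prop
        exact (this.tendsto 0).mono_left nhdsWithin_le_nhds
      have h00 := le_of_tendsto_of_tendsto hcl hcr (eventually_nhdsWithin_iff.2 hC)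
      filter_upwards [hC] with τ hτ
      rcases eq_or_ne τ 0 with rfl | hne
      · exact h00
      · exact hτ hne
    intro i hi
    cases i with
    | zero => exact h00
    | succ i => exact ih h2 i (by omega)

theorem iteratedDeriv_sum_pow_smul {m : ℕ} (a : ℕ → F) {k : ℕ} (hk : k ≤ m) :
    iteratedDeriv k (fun τ : ℝ => ∑ i ∈ Finset.range (m + 1), τ ^ i • a i) 0 =
      (k ! : ℝ) • a k := by
  rw [iteratedDeriv_fun_sum fun i _ => by fun_prop]
  have : ∀ i, iteratedDeriv k (fun τ : ℝ => τ ^ i • a i) 0 =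
      if k = i then (i ! : ℝ) • a i else 0 := by
    intro i
    have h1 := iteratedDeriv_smul_const (𝕜 := ℝ) (n := k) (f := fun τ : ℝ => τ ^ i) (x := 0)
      (by fun_prop) (a i)
    refine h1.trans ?_
    rw [iteratedDeriv_fun_pow_zero]
    split_ifs <;> simp
  simp only [this]
  rw [Finset.sum_ite_eq, if_pos (by simp; omega)]

/-- The derivatives at `0` of a smooth function of order `O(τ^N)` vanish below order `N`. -/
theorem iteratedDeriv_eq_zero_of_isBigO {u : ℝ → F} {N : ℕ} (hu : SmoothNear u 0)
    (h : u =O[𝓝 0] fun τ => τ ^ N) : ∀ i < N, iteratedDeriv i u 0 = 0 := by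
  intro i hi
  obtain ⟨m, rfl⟩ : ∃ m, N = m + 1 := ⟨N - 1, by omega⟩
  -- the difference of `u` and its Taylor polynomial `P` is `O(τ^N)`, hence so is `P`
  let P : ℝ → F := fun τ => ∑ i ∈ Finset.range (m + 1), τ ^ i • ((i ! : ℝ)⁻¹ • iteratedDeriv i u 0)
  have hP : ContDiff ℝ ∞ P := by fun_prop
  have hcomp : SmoothNear (fun x : ℝ × ℝ => u x.2 - P x.2) ((0 : ℝ), (0 : ℝ)) :=
    SmoothNear.comp (g := fun τ => u τ - P τ) (hu.sub (hP.smoothNear _)) (contDiff_snd.smoothNear _)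
  have h1 := isBigO_pow_of_iteratedDeriv (N := m + 1) hcomp (by
    intro k hk
    refine Eventually.of_forall fun p => ?_
    have h2 : iteratedDeriv k (u - P) 0 = _ :=
      iteratedDeriv_sub (hu.contDiffAt.of_le (by exact_mod_cast le_top))
        (hP.contDiffAt.of_le (by exact_mod_cast le_top))
    refine h2.trans ?_
    rw [iteratedDeriv_sum_pow_smul _ (by omega : k ≤ m), smul_smul, mul_inv_cancel₀ (by positivity),
      one_smul, sub_self])
  have h3 : (fun τ : ℝ => u τ - P τ) =O[𝓝 0] fun τ => τ ^ (m + 1) :=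
    h1.comp_tendsto (k := fun τ : ℝ => ((0 : ℝ), τ)) (Continuous.prodMk_right (0 : ℝ)).continuousAt
  have h4 : P =O[𝓝 0] fun τ => τ ^ (m + 1) := (h.sub h3).congr_left fun τ => by simp
  have h5 := eq_zero_of_sum_pow_smul_isBigO h4 i (by omega)
  rcases smul_eq_zero.1 h5 with h6 | h6
  · exact absurd h6 (by positivity)
  · exact h6

theorem isBigO_slice {X H : Type*} [TopologicalSpace X] [NormedAddCommGroup H] {r : X × ℝ → H}
    {p₀ : X} {N : ℕ}
    (h : r =O[𝓝 (p₀, 0)] fun x => x.2 ^ N) :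
    ∀ᶠ p in 𝓝 p₀, (fun τ => r (p, τ)) =O[𝓝 0] fun τ => τ ^ N := by
  obtain ⟨C, hC⟩ := h.bound
  filter_upwards [(tendsto_prodMk_zero p₀).eventually hC.eventually_nhds] with p hp
  exact Asymptotics.IsBigO.of_bound C
    ((Continuous.prodMk_right p).continuousAt (x := (0 : ℝ)) |>.eventually hp)

theorem SmoothNear.slice {r : E × ℝ → F} {p₀ : E} (h : SmoothNear r (p₀, 0)) :
    ∀ᶠ p in 𝓝 p₀, SmoothNear (fun τ => r (p, τ)) 0 := by
  filter_upwards [(tendsto_prodMk_zero p₀).eventually h.eventually] with p hp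
  exact SmoothNear.comp hp (ContDiff.smoothNear (by fun_prop) _)

theorem iteratedDeriv_eventually_eq_zero {r : E × ℝ → F} {p₀ : E} {N : ℕ}
    (hr : SmoothNear r (p₀, 0)) (h : r =O[𝓝 (p₀, 0)] fun x => x.2 ^ N) {i : ℕ} (hi : i < N) :
    ∀ᶠ p in 𝓝 p₀, iteratedDeriv i (fun τ => r (p, τ)) 0 = 0 := by
  filter_upwards [hr.slice, isBigO_slice h] with p h1 h2
  exact iteratedDeriv_eq_zero_of_isBigO h1 h2 i hi

/-- The `τ`-derivatives commute with a derivative in a direction `(u, 0)`. -/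
theorem SmoothNear.iteratedDeriv_fderiv {r : E × ℝ → F} {p₀ : E} (hr : SmoothNear r (p₀, 0))
    (u : E) (i : ℕ) : ∀ᶠ p in 𝓝 p₀,
      iteratedDeriv i (fun τ => fderiv ℝ r (p, τ) (u, 0)) 0 =
        fderiv ℝ (fun q => iteratedDeriv i (fun τ => r (q, τ)) 0) p u := by
  induction i generalizing r with
  | zero =>
    filter_upwards [(tendsto_prodMk_zero p₀).eventually hr.eventually] with p hp
    simp only [iteratedDeriv_zero]
    have h1 : HasFDerivAt (fun q : E => (q, (0 : ℝ))) (ContinuousLinearMap.inl ℝ E ℝ) p :=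
      (ContinuousLinearMap.inl ℝ E ℝ).hasFDerivAt
    have h2 := (hp.differentiableAt.hasFDerivAt.comp p h1).fderiv
    rw [Function.comp_def] at h2
    rw [h2]
    simp
  | succ i ih =>
    have key : timeDeriv (fun x => fderiv ℝ r x (u, 0)) =ᶠ[𝓝 (p₀, 0)]
        fun x => fderiv ℝ (timeDeriv r) x (u, 0) := by
      filter_upwards [hr.eventually] with x hx
      rw [timeDeriv_eq (hx.fderiv.clm_apply (contDiff_const.smoothNear _)).differentiableAt,
        hx.fderiv_fderiv_comm, hx.timeDeriv_eventuallyEq.fderiv_eq]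
    filter_upwards [ih hr.timeDeriv, (tendsto_prodMk_zero p₀).eventually key.eventually_nhds]
      with p hp hp'
    simp only [iteratedDeriv_succ']
    refine Eq.trans ?_ hp
    refine Filter.EventuallyEq.iteratedDeriv_eq i ?_
    exact (Continuous.prodMk_right p).continuousAt (x := (0 : ℝ)) |>.eventually hp'

/-- A derivative transversal to `τ` does not lower the order of vanishing at `τ = 0` of a smooth
map. -/
theorem SmoothNear.isBigO_fderiv {r : E × ℝ → F} {p₀ : E} {N : ℕ} (hr : SmoothNear r (p₀, 0))
    (h : r =O[𝓝 (p₀, 0)] fun x => x.2 ^ N) (u : E) :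
    (fun x => fderiv ℝ r x (u, 0)) =O[𝓝 (p₀, 0)] fun x => x.2 ^ N := by
  refine isBigO_pow_of_iteratedDeriv (hr.fderiv.clm_apply (contDiff_const.smoothNear _)) ?_
  intro i hi
  filter_upwards [hr.iteratedDeriv_fderiv u i,
    (iteratedDeriv_eventually_eq_zero hr h hi).eventually_nhds] with p h1 h2
  rw [h1]
  have : (fun q => iteratedDeriv i (fun τ => r (q, τ)) 0) =ᶠ[𝓝 p] fun _ => 0 := h2
  rw [this.fderiv_eq]
  simp

end Germs

/-! ### Implicit functions -/

section Implicit

variable {E₁ E₂ : Type*} [NormedAddCommGroup E₁] [NormedSpace ℝ E₁] [FiniteDimensional ℝ E₁]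
  [NormedAddCommGroup E₂] [NormedSpace ℝ E₂] [FiniteDimensional ℝ E₂]

/-- The implicit function theorem in finite dimension, with smoothness of the solution `g` in a full
neighbourhood and uniqueness of the solution in a fixed neighbourhood `V`. -/
theorem exists_implicit {H : E₁ × E₂ → E₁} {a₀ : E₁} {b₀ : E₂} (hH : SmoothNear H (a₀, b₀))
    (h0 : H (a₀, b₀) = 0) (hinj : ∀ v, fderiv ℝ H (a₀, b₀) (v, 0) = 0 → v = 0) :
    ∃ g : E₂ → E₁, SmoothNear g b₀ ∧ g b₀ = a₀ ∧ ∃ V : Set E₁, IsOpen V ∧ a₀ ∈ V ∧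
      ∀ᶠ b in 𝓝 b₀, g b ∈ V ∧ ∀ a ∈ V, H (a, b) = 0 ↔ a = g b := by
  have : CompleteSpace E₁ := FiniteDimensional.complete ℝ E₁
  have : CompleteSpace E₂ := FiniteDimensional.complete ℝ E₂
  let Φ : E₁ × E₂ → E₁ × E₂ := fun x => (H x, x.2)
  have hΦ : SmoothNear Φ (a₀, b₀) := hH.prodMk (contDiff_snd.smoothNear _)
  have hder : ∀ x, SmoothNear H x →
      HasFDerivAt Φ ((fderiv ℝ H x).prod (ContinuousLinearMap.snd ℝ E₁ E₂)) x := fun x hx =>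
    hx.differentiableAt.hasFDerivAt.prodMk hasFDerivAt_snd
  have hinj' : Function.Injective
      ((fderiv ℝ H (a₀, b₀)).prod (ContinuousLinearMap.snd ℝ E₁ E₂)) := by
    rw [injective_iff_map_eq_zero]
    rintro ⟨u, v⟩ h
    simp only [ContinuousLinearMap.prod_apply, ContinuousLinearMap.coe_snd', Prod.mk_eq_zero] at h
    obtain ⟨h1, rfl⟩ := h
    rw [hinj u h1]; rfl
  let e : (E₁ × E₂) ≃L[ℝ] (E₁ × E₂) := (LinearEquiv.ofInjectiveEndo
    ((fderiv ℝ H (a₀, b₀)).prod (ContinuousLinearMap.snd ℝ E₁ E₂) : (E₁ × E₂) →ₗ[ℝ] (E₁ × E₂))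
      hinj').toContinuousLinearEquiv
  have he : (e : (E₁ × E₂) →L[ℝ] (E₁ × E₂)) =
      (fderiv ℝ H (a₀, b₀)).prod (ContinuousLinearMap.snd ℝ E₁ E₂) := by
    ext x <;> rfl
  have hder0 : HasFDerivAt Φ (e : (E₁ × E₂) →L[ℝ] (E₁ × E₂)) (a₀, b₀) := by
    rw [he]; exact hder _ hH
  let Ψ := hΦ.contDiffAt.toOpenPartialHomeomorph Φ hder0 (by simp)
  have hΨ : (Ψ : E₁ × E₂ → E₁ × E₂) = Φ := rfl
  have hsrc : (a₀, b₀) ∈ Ψ.source := hΦ.contDiffAt.mem_toOpenPartialHomeomorph_source hder0 _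
  have hΦ0 : Φ (a₀, b₀) = (0, b₀) := by simp [Φ, h0]
  have htgt : ((0 : E₁), b₀) ∈ Ψ.target := by
    rw [← hΦ0]; exact Ψ.map_source hsrc
  have hsymm0 : Ψ.symm (0, b₀) = (a₀, b₀) := by
    rw [← hΦ0]; exact Ψ.left_inv hsrc
  have hcs : ContinuousAt Ψ.symm (0, b₀) := Ψ.continuousAt_symm htgt
  have hinv : ∀ᶠ x in 𝓝 (a₀, b₀), ∃ e' : (E₁ × E₂) ≃L[ℝ] (E₁ × E₂),
      HasFDerivAt Φ (e' : (E₁ × E₂) →L[ℝ] (E₁ × E₂)) x := by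
    have hc : ContinuousAt (fderiv ℝ Φ) (a₀, b₀) := hΦ.fderiv.continuousAt
    have hn : Set.range ((↑) : ((E₁ × E₂) ≃L[ℝ] (E₁ × E₂)) → (E₁ × E₂) →L[ℝ] (E₁ × E₂)) ∈
        𝓝 (fderiv ℝ Φ (a₀, b₀)) := by
      rw [hder0.fderiv]; exact ContinuousLinearEquiv.nhds e
    filter_upwards [hc.eventually hn, hΦ.eventually] with x hx hx'
    obtain ⟨e', he'⟩ := hx
    exact ⟨e', by rw [he']; exact hx'.differentiableAt.hasFDerivAt⟩
  have hsm : SmoothNear Ψ.symm (0, b₀) := by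
    filter_upwards [Ψ.open_target.mem_nhds htgt,
      hcs.eventually (by rw [hsymm0]; exact hinv.and hΦ)] with y hy hy'
    obtain ⟨⟨e', he'⟩, h⟩ := hy'
    exact Ψ.contDiffAt_symm hy he' h
  have hlift : Tendsto (fun b : E₂ => ((0 : E₁), b)) (𝓝 b₀) (𝓝 (0, b₀)) :=
    (Continuous.prodMk_right (0 : E₁)).tendsto b₀
  have hg : SmoothNear (fun b => (Ψ.symm ((0 : E₁), b)).1) b₀ := by
    have h1 : SmoothNear (fun b => Ψ.symm ((0 : E₁), b)) b₀ :=
      SmoothNear.comp (g := Ψ.symm) hsm (ContDiff.smoothNear (by fun_prop) _)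
    exact SmoothNear.comp (g := Prod.fst) (contDiff_fst.smoothNear _) h1
  have hg0 : (Ψ.symm ((0 : E₁), b₀)).1 = a₀ := by rw [hsymm0]
  obtain ⟨V, hVn, W, hWn, hVW⟩ := mem_nhds_prod_iff.1 (Ψ.open_source.mem_nhds hsrc)
  obtain ⟨V', hV'V, hV'o, haV'⟩ := mem_nhds_iff.1 hVn
  refine ⟨fun b => (Ψ.symm ((0 : E₁), b)).1, hg, hg0, V', hV'o, haV', ?_⟩
  have hgV : ∀ᶠ b in 𝓝 b₀, (Ψ.symm ((0 : E₁), b)).1 ∈ V' :=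
    hg.continuousAt.eventually (hV'o.mem_nhds (by simpa only [hg0] using haV'))
  filter_upwards [hgV, hWn, hlift.eventually (Ψ.open_target.mem_nhds htgt)] with b hb hbW hbt
  refine ⟨hb, fun a ha => ⟨fun h => ?_, fun h => ?_⟩⟩
  · have h1 : (a, b) ∈ Ψ.source := hVW ⟨hV'V ha, hbW⟩
    have h2 : Ψ (a, b) = (0, b) := by rw [hΨ]; simp [Φ, h]
    rw [← h2, Ψ.left_inv h1]
  · have h1 : Φ (Ψ.symm (0, b)) = (0, b) := Ψ.right_inv hbt
    have h2 : (Ψ.symm ((0 : E₁), b)).2 = b := congrArg Prod.snd h1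
    have h3 : H (Ψ.symm (0, b)) = 0 := congrArg Prod.fst h1
    have h4 : Ψ.symm ((0 : E₁), b) = (a, b) := Prod.ext h.symm h2
    rwa [h4] at h3

end Implicit

/-! ### Solutions and approximate solutions of ordinary differential equations -/

section ODE

variable {E : Type*} [NormedAddCommGroup E] [NormedSpace ℝ E] [FiniteDimensional ℝ E]

/-- For initial data near `(z₀, t₀)`, uniformly: the initial value problem is solvable, and an
approximate solution with defect `ε` stays within `L ε τ` of every solution over a time `τ`. -/
theorem exists_solution_and_defect_bound {X : E → ℝ → E}
    (hX : ContDiff ℝ ∞ fun p : E × ℝ => X p.1 p.2) (z₀ : E) (t₀ : ℝ) :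
    ∃ τ₁ > (0 : ℝ), ∃ L : ℝ, 0 ≤ L ∧ ∀ t, |t - t₀| < τ₁ → ∀ z ∈ Metric.ball z₀ (1 / 2),
      ∀ τ, 0 < τ → τ < τ₁ →
      (∃ y : ℝ → E, y t = z ∧ ∀ σ ∈ Set.Icc t (t + τ),
        HasDerivWithinAt y (X (y σ) σ) (Set.Icc t (t + τ)) σ) ∧
      ∀ y : ℝ → E, y t = z → (∀ σ ∈ Set.Icc t (t + τ),
        HasDerivWithinAt y (X (y σ) σ) (Set.Icc t (t + τ)) σ) →
      ∀ (g g' : ℝ → E) (ε : ℝ), g t = z → (∀ σ ∈ Set.Icc t (t + τ), HasDerivAt g (g' σ) σ) →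
        (∀ σ ∈ Set.Icc t (t + τ), g σ ∈ Metric.closedBall z₀ 1) →
        (∀ σ ∈ Set.Icc t (t + τ), ‖g' σ - X (g σ) σ‖ ≤ ε) →
        ‖g (t + τ) - y (t + τ)‖ ≤ L * ε * τ := by
  have : CompleteSpace E := FiniteDimensional.complete ℝ E
  have : ProperSpace E := FiniteDimensional.proper ℝ E
  set B : Set (E × ℝ) := Metric.closedBall z₀ 1 ×ˢ Set.Icc (t₀ - 1) (t₀ + 1) with hB
  have hBc : IsCompact B := (isCompact_closedBall _ _).prod isCompact_Icc
  have hBv : Convex ℝ B := (convex_closedBall _ _).prod (convex_Icc _ _)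
  obtain ⟨K, hK⟩ := hX.contDiffOn.exists_lipschitzOnWith (s := B) (by simp) hBv hBc
  obtain ⟨M, hM⟩ := hBc.exists_bound_of_continuousOn hX.continuous.continuousOn
  have hz₀B : (z₀, t₀) ∈ B := by simp [hB]
  have hM0 : 0 ≤ M := (norm_nonneg _).trans (hM _ hz₀B)
  have hLip : ∀ t, t ∈ Set.Icc (t₀ - 1) (t₀ + 1) →
      LipschitzOnWith (K + 1) (fun z => X z t) (Metric.closedBall z₀ 1) := by
    intro t ht x hx y hy
    have h1 := hK (x := (x, t)) ⟨hx, ht⟩ (y := (y, t)) ⟨hy, ht⟩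
    rw [Prod.edist_eq, edist_self, max_eq_left zero_le] at h1
    refine h1.trans ?_
    gcongr
    exact_mod_cast le_self_add
  -- within a time `1 / (2 (M + 1))` a solution moves by less than `1 / 2`
  refine ⟨min (1 / 2) (1 / (2 * (M + 1))), by positivity, Real.exp (K + 1), by positivity, ?_⟩
  intro t ht z hz τ hτ0 hτ
  have ht1 := ht.trans_le (min_le_left _ _)
  have hτ1 := hτ.trans_le (min_le_left _ _)
  have hτ2 : (M + 1) * τ ≤ 1 / 2 := by
    have := (hτ.trans_le (min_le_right _ _)).le
    rw [le_div_iff₀ (by positivity)] at this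
    linarith
  rw [abs_lt] at ht1
  have htime : ∀ σ ∈ Set.Icc t (t + τ), σ ∈ Set.Icc (t₀ - 1) (t₀ + 1) := fun σ hσ =>
    ⟨by linarith [hσ.1], by linarith [hσ.2]⟩
  refine ⟨?_, ?_⟩
  · have hPL : IsPicardLindelof (fun t z => X z t) (tmin := t) (tmax := t + τ)
        ⟨t, by simp [hτ0.le]⟩ z₀ 1 (1 / 2) ⟨M + 1, by positivity⟩ (K + 1) := by
      refine ⟨fun σ hσ => by simpa using hLip σ (htime σ hσ), fun x _ => ?_, ?_, ?_⟩
      · exact (hX.continuous.comp (Continuous.prodMk_right x)).continuousOn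
      · intro σ hσ x hx
        refine (hM (x, σ) ⟨by simpa using hx, htime σ hσ⟩).trans ?_
        change M ≤ M + 1
        linarith
      · have h1 : max (t + τ - t) (t - t) = τ := by simp [hτ0.le]
        simp only [h1]
        change (M + 1) * τ ≤ ((1 : NNReal) : ℝ) - ((1 / 2 : NNReal) : ℝ)
        push_cast
        linarith
    obtain ⟨y, hy1, hy2⟩ := hPL.exists_eq_forall_mem_Icc_hasDerivWithinAt
      (x := z) (by simpa using (Metric.mem_ball.1 hz).le)
    exact ⟨y, hy1, hy2⟩
  · intro y hy0 hy g g' ε hg0 hg hgB hgε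
    have hyc : ContinuousOn y (Set.Icc t (t + τ)) := fun σ hσ => (hy σ hσ).continuousWithinAt
    have hyr : ∀ σ ∈ Set.Ico t (t + τ), HasDerivWithinAt y (X (y σ) σ) (Set.Ici σ) σ := by
      intro σ hσ
      refine (hy σ ⟨hσ.1, hσ.2.le⟩).mono_of_mem_nhdsWithin ?_
      exact mem_of_superset (Icc_mem_nhdsGE hσ.2) (Set.Icc_subset_Icc_left hσ.1)
    -- the speed bound keeps the solution in the unit ball
    have hyB : ∀ σ ∈ Set.Icc t (t + τ), y σ ∈ Metric.closedBall z₀ 1 := by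
      have hfence := image_norm_le_of_norm_deriv_right_lt_deriv_boundary
        (f := fun σ => y σ - z₀) (f' := fun σ => X (y σ) σ) (a := t) (b := t + τ)
        (B := fun σ => 1 / 2 + (M + 1) * (σ - t)) (B' := fun _ => M + 1)
        (hyc.sub continuousOn_const) (fun σ hσ => (hyr σ hσ).sub_const _)
        (by
          rw [hy0, sub_self, mul_zero, add_zero, ← dist_eq_norm]
          exact (Metric.mem_ball.1 hz).le)
        (fun σ => by
          have h1 := (((hasDerivAt_id σ).sub_const t).const_mul (M + 1)).const_add (1 / 2)
          simpa using h1)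
        (by
          intro σ hσ hnorm
          have h1 : (M + 1) * (σ - t) ≤ (M + 1) * τ := by
            apply mul_le_mul_of_nonneg_left _ (by positivity)
            linarith [hσ.2]
          have h2 : y σ ∈ Metric.closedBall z₀ 1 := by
            rw [Metric.mem_closedBall, dist_eq_norm]
            linarith
          have h3 := hM (y σ, σ) ⟨h2, htime σ ⟨hσ.1, hσ.2.le⟩⟩
          linarith)
      intro σ hσ
      have h1 : (M + 1) * (σ - t) ≤ (M + 1) * τ := by
        apply mul_le_mul_of_nonneg_left _ (by positivity)
        linarith [hσ.2]
      have h2 := hfence hσ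
      rw [Metric.mem_closedBall, dist_eq_norm]
      linarith
    have hε0 : 0 ≤ ε := (norm_nonneg _).trans (hgε t ⟨le_rfl, by linarith⟩)
    have hG := dist_le_of_approx_trajectories_ODE_of_mem
      (v := fun t z => X z t) (s := fun _ => Metric.closedBall z₀ 1) (K := K + 1)
      (f := g) (f' := g') (g := y) (g' := fun σ => X (y σ) σ) (a := t) (b := t + τ)
      (εf := ε) (εg := 0) (δ := 0)
      (fun σ hσ => hLip σ (htime σ ⟨hσ.1, hσ.2.le⟩))
      (fun σ hσ => (hg σ hσ).continuousAt.continuousWithinAt)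
      (fun σ hσ => (hg σ ⟨hσ.1, hσ.2.le⟩).hasDerivWithinAt)
      (fun σ hσ => by rw [dist_eq_norm]; exact hgε σ ⟨hσ.1, hσ.2.le⟩)
      (fun σ hσ => hgB σ ⟨hσ.1, hσ.2.le⟩) hyc hyr (fun σ _ => by simp)
      (fun σ hσ => hyB σ ⟨hσ.1, hσ.2.le⟩) (by rw [hg0, hy0, dist_self])
      (t + τ) ⟨by linarith, le_rfl⟩
    rw [dist_eq_norm] at hG
    refine hG.trans ?_
    have hKne : ((K + 1 : NNReal) : ℝ) ≠ 0 := by positivity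
    rw [gronwallBound_of_K_ne_0 hKne]
    simp only [zero_mul, zero_add, add_zero, add_sub_cancel_left]
    set k : ℝ := ((K + 1 : NNReal) : ℝ) with hk
    have hk0 : 0 < k := by rw [hk]; positivity
    -- `exp x - 1 ≤ x exp x`
    have h1 : Real.exp (k * τ) - 1 ≤ k * τ * Real.exp (k * τ) := by
      have h2 := Real.add_one_le_exp (-(k * τ))
      rw [Real.exp_neg] at h2
      have h3 := Real.exp_pos (k * τ)
      have h4 := mul_le_mul_of_nonneg_right h2 h3.le
      rw [inv_mul_cancel₀ h3.ne'] at h4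
      linarith
    have h2 : Real.exp (k * τ) ≤ Real.exp (K + 1) := by
      apply Real.exp_le_exp.2
      have : k = K + 1 := by rw [hk]; push_cast; rfl
      rw [← this]
      nlinarith
    calc ε / k * (Real.exp (k * τ) - 1) ≤ ε / k * (k * τ * Real.exp (k * τ)) := by gcongr
      _ = Real.exp (k * τ) * ε * τ := by field_simp
      _ ≤ Real.exp (K + 1) * ε * τ := by gcongr

end ODE

/-! ### Dot products, partial derivatives and Jacobian matrices -/

section Calculus

variable {E F G : Type*} [NormedAddCommGroup E] [NormedSpace ℝ E]
  [NormedAddCommGroup F] [NormedSpace ℝ F] [NormedAddCommGroup G] [NormedSpace ℝ G]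
  {ι : Type*} [Fintype ι]

protected theorem SmoothNear.dotProduct {f g : E → ι → ℝ} {x : E} (hf : SmoothNear f x)
    (hg : SmoothNear g x) : SmoothNear (fun y => f y ⬝ᵥ g y) x :=
  SmoothNear.sum fun i _ => (hf.apply i).mul (hg.apply i)

theorem fderiv_dotProduct {f g : E → ι → ℝ} {x : E} (hf : DifferentiableAt ℝ f x)
    (hg : DifferentiableAt ℝ g x) (u : E) :
    fderiv ℝ (fun y => f y ⬝ᵥ g y) x u = fderiv ℝ f x u ⬝ᵥ g x + f x ⬝ᵥ fderiv ℝ g x u := by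
  have hf' := hasFDerivAt_pi'.1 hf.hasFDerivAt
  have hg' := hasFDerivAt_pi'.1 hg.hasFDerivAt
  have h : HasFDerivAt (fun y => f y ⬝ᵥ g y) _ x :=
    HasFDerivAt.fun_sum (u := Finset.univ) fun i _ => (hf' i).mul (hg' i)
  rw [h.fderiv]
  simp [dotProduct, Finset.sum_add_distrib, mul_comm, add_comm]

theorem isBigO_dotProduct {X : Type*} [TopologicalSpace X] {f g : X → ι → ℝ} {x₀ : X} {ρ : X → ℝ}
    (hf : ContinuousAt f x₀)
    (hg : g =O[𝓝 x₀] ρ) : (fun x => f x ⬝ᵥ g x) =O[𝓝 x₀] ρ := by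
  refine Asymptotics.IsBigO.fun_sum fun i _ => ?_
  have h1 : (fun x => f x i) =O[𝓝 x₀] fun _ => (1 : ℝ) :=
    (continuousAt_pi.1 hf i).isBigO_one ℝ
  have h2 : (fun x => g x i) =O[𝓝 x₀] ρ :=
    (Asymptotics.IsBigO.of_norm_le fun x => norm_le_pi_norm (g x) i).trans hg.norm_left
  simpa using h1.mul h2

theorem isBigO_clm_apply {X : Type*} [TopologicalSpace X] {A : X → F →L[ℝ] G} {g : X → F}
    {x₀ : X} {ρ : X → ℝ}
    (hA : ContinuousAt A x₀) (hg : g =O[𝓝 x₀] ρ) : (fun x => A x (g x)) =O[𝓝 x₀] ρ := by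
  have h1 : A =O[𝓝 x₀] fun _ => (1 : ℝ) := hA.isBigO_one ℝ
  have h2 : (fun x => A x (g x)) =O[𝓝 x₀] fun x => ‖A x‖ * ‖g x‖ :=
    Asymptotics.IsBigO.of_bound 1 (Eventually.of_forall fun x => by
      simpa using (A x).le_opNorm (g x))
  simpa using h2.trans (h1.norm_left.mul hg.norm_left)

theorem fderiv_partial_left {f : E × F → G} {a : E} {b : F} (hf : DifferentiableAt ℝ f (a, b))
    (u : E) : fderiv ℝ (fun x => f (x, b)) a u = fderiv ℝ f (a, b) (u, 0) := by
  have h : fderiv ℝ (fun x => f (x, b)) a = _ :=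
    (hf.hasFDerivAt.comp a (hasFDerivAt_prodMk_left a b)).fderiv
  rw [h]; simp

theorem fderiv_partial_right {f : E × F → G} {a : E} {b : F} (hf : DifferentiableAt ℝ f (a, b))
    (v : F) : fderiv ℝ (fun y => f (a, y)) b v = fderiv ℝ f (a, b) (0, v) := by
  have h : fderiv ℝ (fun y => f (a, y)) b = _ :=
    (hf.hasFDerivAt.comp b (hasFDerivAt_prodMk_right a b)).fderiv
  rw [h]; simp

/-- The total derivative of `f(z, t)` as the sum of its partial derivatives. -/
theorem fderiv_uncurry {f : E → ℝ → F} {z : E} {t : ℝ}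
    (hf : DifferentiableAt ℝ (fun p : E × ℝ => f p.1 p.2) (z, t)) (a : E) (b : ℝ) :
    fderiv ℝ (fun p : E × ℝ => f p.1 p.2) (z, t) (a, b) =
      fderiv ℝ (fun z' => f z' t) z a + b • deriv (fun t' => f z t') t := by
  have h1 := fderiv_partial_left hf a
  have h2 := fderiv_partial_right hf b
  simp only at h1 h2
  rw [h1, ← fderiv_eq_smul_deriv, h2, ← map_add]
  simp

theorem jacobian_mulVec {n : ℕ} (g : Phase n → Phase n) (z v : Phase n) :
    (jacobian g z).mulVec v = fderiv ℝ g z v := by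
  have h : jacobian g z = LinearMap.toMatrix' (fderiv ℝ g z : Phase n →ₗ[ℝ] Phase n) := by
    ext i j
    simp [jacobian, LinearMap.toMatrix'_apply]
  rw [h, LinearMap.toMatrix'_mulVec]
  rfl

theorem grad_dotProduct {n : ℕ} (b : Phase n → ℝ) (z v : Phase n) :
    grad b z ⬝ᵥ v = fderiv ℝ b z v := by
  conv_rhs => rw [← Finset.univ_sum_single v, map_sum]
  refine Finset.sum_congr rfl fun i _ => ?_
  have : Pi.single i (v i) = v i • (Pi.single i 1 : Phase n) := by
    rw [← Pi.single_smul, smul_eq_mul, mul_one]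
  rw [this, map_smul, smul_eq_mul, mul_comm]; rfl

end Calculus

/-! ### The two-form and the vector field of a Birkhoffian system -/

namespace System

variable {n : ℕ} (S : System n)

/-- The two-form `uᵀ K(z,t) v`, written as the exterior derivative of the one-form `F · dz`. -/
def form (z : Phase n) (t : ℝ) (u v : Phase n) : ℝ :=
  fderiv ℝ (fun z' => S.F z' t) z u ⬝ᵥ v - fderiv ℝ (fun z' => S.F z' t) z v ⬝ᵥ u

theorem dotProduct_K_mulVec (z : Phase n) (t : ℝ) (u v : Phase n) :
    u ⬝ᵥ (S.K z t).mulVec v = S.form z t u v := by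
  have h : S.K z t = (jacobian (fun z' => S.F z' t) z).transpose -
      jacobian (fun z' => S.F z' t) z := by
    ext i j; rfl
  rw [h, Matrix.sub_mulVec, dotProduct_sub, Matrix.mulVec_transpose, dotProduct_comm u,
    ← Matrix.dotProduct_mulVec, jacobian_mulVec, jacobian_mulVec, form,
    dotProduct_comm v, dotProduct_comm u]

theorem form_sum_left {ι : Type*} (s : Finset ι) (z : Phase n) (t : ℝ) (u : ι → Phase n)
    (v : Phase n) : S.form z t (∑ i ∈ s, u i) v = ∑ i ∈ s, S.form z t (u i) v := by
  simp only [form, map_sum, sum_dotProduct, dotProduct_sum, Finset.sum_sub_distrib]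

theorem form_smul_left (z : Phase n) (t c : ℝ) (u v : Phase n) :
    S.form z t (c • u) v = c * S.form z t u v := by
  simp only [form, map_smul, smul_dotProduct, dotProduct_smul, smul_eq_mul]; ring

theorem form_swap (z : Phase n) (t : ℝ) (u v : Phase n) : S.form z t u v = -S.form z t v u := by
  simp only [form]; ring

/-- The vector field `K⁻¹ (∇B + ∂F/∂t)`, whose integral curves are the solutions of a regular
system. -/
def field (z : Phase n) (t : ℝ) : Phase n := (S.K z t)⁻¹.mulVec (S.force z t)

theorem smoothNear_fderiv_F {E : Type*} [NormedAddCommGroup E] [NormedSpace ℝ E]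
    {a : E → Phase n} {t : E → ℝ} {x : E} (ha : SmoothNear a x) (ht : SmoothNear t x) :
    SmoothNear (fun y => fderiv ℝ (fun z' => S.F z' (t y)) (a y)) x := by
  refine SmoothNear.fderiv_comp (f := fun y z' => S.F z' (t y)) ?_ ha
  exact SmoothNear.comp (g := fun p : Phase n × ℝ => S.F p.1 p.2) (S.smooth_F.smoothNear _)
    ((contDiff_snd.smoothNear _).prodMk
      (SmoothNear.comp (g := t) (f := Prod.fst) ht (contDiff_fst.smoothNear _)))

variable {S} in
theorem K_mulVec_field (hS : S.Regular) (z : Phase n) (t : ℝ) :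
    (S.K z t).mulVec (S.field z t) = S.force z t := by
  rw [field, Matrix.mulVec_mulVec, Matrix.mul_nonsing_inv _ (hS z t).isUnit, Matrix.one_mulVec]

variable {S} in
theorem eq_field (hS : S.Regular) {z v : Phase n} {t : ℝ}
    (h : (S.K z t).mulVec v = S.force z t) : v = S.field z t := by
  rw [field, ← h, Matrix.mulVec_mulVec, Matrix.nonsing_inv_mul _ (hS z t).isUnit,
    Matrix.one_mulVec]

variable {S} in
/-- Contracting the two-form with the vector field gives minus the exterior derivative of `B` minus
the time derivative of the one-form. -/
theorem form_field (hS : S.Regular) (z : Phase n) (t : ℝ) (w : Phase n) :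
    S.form z t w (S.field z t) =
      fderiv ℝ (fun z' => S.B z' t) z w + deriv (fun t' => S.F z t') t ⬝ᵥ w := by
  rw [← dotProduct_K_mulVec, K_mulVec_field hS, dotProduct_comm, force, add_dotProduct,
    grad_dotProduct]

theorem contDiff_K (i j : Fin (2 * n)) : ContDiff ℝ ∞ fun p : Phase n × ℝ => S.K p.1 p.2 i j := by
  have h : ContDiff ℝ ∞ fun p : Phase n × ℝ => fderiv ℝ (fun z' => S.F z' p.2) p.1 := by
    refine ContDiff.fderiv (m := ∞) (n := ∞) (f := fun (p : Phase n × ℝ) z' => S.F z' p.2) ?_ contDiff_fst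
      (by simp)
    exact S.smooth_F.comp (contDiff_snd.prodMk (contDiff_snd.comp contDiff_fst))
  have h2 : ∀ i j, ContDiff ℝ ∞ fun p : Phase n × ℝ =>
      fderiv ℝ (fun z' => S.F z' p.2) p.1 (Pi.single j 1) i := fun i j =>
    contDiff_pi.1 (h.clm_apply contDiff_const) i
  exact (h2 j i).sub (h2 i j)

theorem contDiff_force : ContDiff ℝ ∞ fun p : Phase n × ℝ => S.force p.1 p.2 := by
  have h1 : ContDiff ℝ ∞ fun p : Phase n × ℝ => fderiv ℝ (fun z' => S.B z' p.2) p.1 := by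
    refine ContDiff.fderiv (m := ∞) (n := ∞) (f := fun (p : Phase n × ℝ) z' => S.B z' p.2) ?_ contDiff_fst
      (by simp)
    exact S.smooth_B.comp (contDiff_snd.prodMk (contDiff_snd.comp contDiff_fst))
  have h2 : ContDiff ℝ ∞ fun p : Phase n × ℝ => fderiv ℝ (fun t' => S.F p.1 t') p.2 := by
    refine ContDiff.fderiv (m := ∞) (n := ∞) (f := fun (p : Phase n × ℝ) t' => S.F p.1 t') ?_ contDiff_snd
      (by simp)
    exact S.smooth_F.comp ((contDiff_fst.comp contDiff_fst).prodMk contDiff_snd)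
  refine ContDiff.add (contDiff_pi.2 fun i => h1.clm_apply contDiff_const) ?_
  exact h2.clm_apply contDiff_const

variable {S} in
/-- The vector field is smooth, by Cramer's rule. -/
theorem contDiff_field (hS : S.Regular) : ContDiff ℝ ∞ fun p : Phase n × ℝ => S.field p.1 p.2 := by
  have hdet : ∀ M : Phase n × ℝ → Matrix (Fin (2 * n)) (Fin (2 * n)) ℝ,
      (∀ i j, ContDiff ℝ ∞ fun p => M p i j) → ContDiff ℝ ∞ fun p => (M p).det := by
    intro M hM
    simp only [Matrix.det_apply']
    exact ContDiff.sum fun σ _ => contDiff_const.mul (contDiff_prod fun i _ => hM _ _)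
  refine contDiff_pi.2 fun i => ?_
  have h : ∀ p : Phase n × ℝ, S.field p.1 p.2 i =
      ((S.K p.1 p.2).det)⁻¹ * ((S.K p.1 p.2).updateCol i (S.force p.1 p.2)).det := by
    intro p
    rw [field, Matrix.inv_def, Matrix.smul_mulVec, ← Matrix.cramer_eq_adjugate_mulVec,
      Ring.inverse_eq_inv', Pi.smul_apply, Matrix.cramer_apply, smul_eq_mul]
  simp only [h]
  refine ContDiff.mul ((hdet _ S.contDiff_K).inv fun p => hS p.1 p.2) (hdet _ fun j k => ?_)
  simp only [Matrix.updateCol_apply]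
  by_cases hk : k = i
  · simpa [hk] using contDiff_pi.1 S.contDiff_force j
  · simpa [hk] using S.contDiff_K j k

end System

/-! ### Symplecticity of approximate flows -/

namespace System

variable {n : ℕ} (S : System n)

section Pullback

variable {E : Type*} [NormedAddCommGroup E] [NormedSpace ℝ E]

theorem smoothNear_F {G : E → Phase n} {t : E → ℝ} {x : E} (hG : SmoothNear G x)
    (ht : SmoothNear t x) : SmoothNear (fun y => S.F (G y) (t y)) x :=
  SmoothNear.comp (g := fun p : Phase n × ℝ => S.F p.1 p.2) (S.smooth_F.smoothNear _)
    (hG.prodMk ht)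

theorem smoothNear_form {G u v : E → Phase n} {t : E → ℝ} {x : E} (hG : SmoothNear G x)
    (ht : SmoothNear t x) (hu : SmoothNear u x) (hv : SmoothNear v x) :
    SmoothNear (fun y => S.form (G y) (t y) (u y) (v y)) x :=
  (((S.smoothNear_fderiv_F hG ht).clm_apply hu).dotProduct hv).sub
    (((S.smoothNear_fderiv_F hG ht).clm_apply hv).dotProduct hu)

theorem fderiv_F_comp {G : E → Phase n} {t : E → ℝ} {x : E} (hG : DifferentiableAt ℝ G x)
    (ht : DifferentiableAt ℝ t x) (u : E) :
    fderiv ℝ (fun y => S.F (G y) (t y)) x u =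
      fderiv ℝ (fun z' => S.F z' (t x)) (G x) (fderiv ℝ G x u) +
        fderiv ℝ t x u • deriv (fun t' => S.F (G x) t') (t x) := by
  have hF : DifferentiableAt ℝ (fun p : Phase n × ℝ => S.F p.1 p.2) (G x, t x) :=
    S.smooth_F.differentiable (by simp) _
  have h : fderiv ℝ (fun y => S.F (G y) (t y)) x = _ :=
    (hF.hasFDerivAt.comp x (f := fun y => (G y, t y))
      (hG.hasFDerivAt.prodMk ht.hasFDerivAt)).fderiv
  rw [h, ContinuousLinearMap.comp_apply, ContinuousLinearMap.prod_apply, fderiv_uncurry hF]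

theorem fderiv_B_comp {G : E → Phase n} {t : E → ℝ} {x : E} (hG : DifferentiableAt ℝ G x)
    (ht : DifferentiableAt ℝ t x) (u : E) :
    fderiv ℝ (fun y => S.B (G y) (t y)) x u =
      fderiv ℝ (fun z' => S.B z' (t x)) (G x) (fderiv ℝ G x u) +
        fderiv ℝ t x u • deriv (fun t' => S.B (G x) t') (t x) := by
  have hB : DifferentiableAt ℝ (fun p : Phase n × ℝ => S.B p.1 p.2) (G x, t x) :=
    S.smooth_B.differentiable (by simp) _
  have h : fderiv ℝ (fun y => S.B (G y) (t y)) x = _ :=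
    (hB.hasFDerivAt.comp x (f := fun y => (G y, t y))
      (hG.hasFDerivAt.prodMk ht.hasFDerivAt)).fderiv
  rw [h, ContinuousLinearMap.comp_apply, ContinuousLinearMap.prod_apply, fderiv_uncurry hB]

/-- The exterior derivative of the pulled back one-form `F · dG` is the pulled back two-form. Here
`u` and `v` are directions in which the time does not change. -/
theorem fderiv_pullback_sub {G : E → Phase n} {t : E → ℝ} {x : E} (hG : SmoothNear G x)
    (ht : SmoothNear t x) {u v : E} (hu : fderiv ℝ t x u = 0) (hv : fderiv ℝ t x v = 0) :
    fderiv ℝ (fun y => S.F (G y) (t y) ⬝ᵥ fderiv ℝ G y v) x u -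
      fderiv ℝ (fun y => S.F (G y) (t y) ⬝ᵥ fderiv ℝ G y u) x v =
      S.form (G x) (t x) (fderiv ℝ G x u) (fderiv ℝ G x v) := by
  have hF := (S.smoothNear_F hG ht).differentiableAt
  have hd : ∀ w : E, DifferentiableAt ℝ (fun y => fderiv ℝ G y w) x := fun w =>
    (hG.fderiv.clm_apply (contDiff_const.smoothNear _)).differentiableAt
  rw [fderiv_dotProduct hF (hd v), fderiv_dotProduct hF (hd u), hG.fderiv_fderiv_comm u v,
    S.fderiv_F_comp hG.differentiableAt ht.differentiableAt,
    S.fderiv_F_comp hG.differentiableAt ht.differentiableAt, hu, hv]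
  simp only [zero_smul, add_zero, form]
  ring

variable {S}

theorem smoothNear_field (hS : S.Regular) {G : E → Phase n} {t : E → ℝ} {x : E}
    (hG : SmoothNear G x) (ht : SmoothNear t x) : SmoothNear (fun y => S.field (G y) (t y)) x :=
  SmoothNear.comp (g := fun p : Phase n × ℝ => S.field p.1 p.2) (f := fun y => (G y, t y))
    ((contDiff_field hS).smoothNear _) (hG.prodMk ht)

/-- Cartan's formula along `G`: the derivative of the pulled back one-form in the time direction `k`
is exact up to the contraction of the two-form with the defect of `G` as a solution. -/
theorem fderiv_pullback (hS : S.Regular) {G : E → Phase n} {t : E → ℝ} {x : E}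
    (hG : SmoothNear G x) (ht : SmoothNear t x) {v k : E} (hv : fderiv ℝ t x v = 0)
    (hk : fderiv ℝ t x k = 1) :
    fderiv ℝ (fun y => S.F (G y) (t y) ⬝ᵥ fderiv ℝ G y v) x k =
      fderiv ℝ (fun y => S.F (G y) (t y) ⬝ᵥ fderiv ℝ G y k - S.B (G y) (t y)) x v -
        S.form (G x) (t x) (fderiv ℝ G x v) (fderiv ℝ G x k - S.field (G x) (t x)) := by
  have hF := (S.smoothNear_F hG ht).differentiableAt
  have hd : ∀ w : E, DifferentiableAt ℝ (fun y => fderiv ℝ G y w) x := fun w =>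
    (hG.fderiv.clm_apply (contDiff_const.smoothNear _)).differentiableAt
  have hB : DifferentiableAt ℝ (fun y => S.B (G y) (t y)) x :=
    (SmoothNear.comp (g := fun p : Phase n × ℝ => S.B p.1 p.2) (S.smooth_B.smoothNear _)
      (hG.prodMk ht)).differentiableAt
  have hFd : DifferentiableAt ℝ (fun y => S.F (G y) (t y) ⬝ᵥ fderiv ℝ G y k) x :=
    ((S.smoothNear_F hG ht).dotProduct
      (hG.fderiv.clm_apply (contDiff_const.smoothNear _))).differentiableAt
  have h1 := form_field hS (G x) (t x) (fderiv ℝ G x v)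
  have h2 : S.form (G x) (t x) (fderiv ℝ G x v) (fderiv ℝ G x k - S.field (G x) (t x)) =
      S.form (G x) (t x) (fderiv ℝ G x v) (fderiv ℝ G x k) -
        S.form (G x) (t x) (fderiv ℝ G x v) (S.field (G x) (t x)) := by
    simp only [form, map_sub, sub_dotProduct, dotProduct_sub]; ring
  rw [fderiv_fun_sub hFd hB, sub_apply, fderiv_dotProduct hF (hd v),
    fderiv_dotProduct hF (hd k), hG.fderiv_fderiv_comm v k,
    S.fderiv_F_comp hG.differentiableAt ht.differentiableAt,
    S.fderiv_F_comp hG.differentiableAt ht.differentiableAt,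
    S.fderiv_B_comp hG.differentiableAt ht.differentiableAt, hv, hk, h2, h1]
  simp only [form, zero_smul, one_smul, add_zero, add_dotProduct]
  ring

/-- The pulled back two-form of a map that solves the equations up to a defect changes in the time
direction `k` only through the contraction with the defect. -/
theorem fderiv_form_pullback (hS : S.Regular) {G : E → Phase n} {t : E → ℝ} {x : E}
    (hG : SmoothNear G x) (ht : SmoothNear t x) {u v k : E} (hu : ∀ y, fderiv ℝ t y u = 0)
    (hv : ∀ y, fderiv ℝ t y v = 0) (hk : ∀ y, fderiv ℝ t y k = 1) :
    fderiv ℝ (fun y => S.form (G y) (t y) (fderiv ℝ G y u) (fderiv ℝ G y v)) x k =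
      fderiv ℝ (fun y => S.form (G y) (t y) (fderiv ℝ G y u)
          (fderiv ℝ G y k - S.field (G y) (t y))) x v -
        fderiv ℝ (fun y => S.form (G y) (t y) (fderiv ℝ G y v)
          (fderiv ℝ G y k - S.field (G y) (t y))) x u := by
  have hD : ∀ w, SmoothNear (fun y => fderiv ℝ G y w) x := fun w =>
    hG.fderiv.clm_apply (contDiff_const.smoothNear _)
  have hdef : SmoothNear (fun y => fderiv ℝ G y k - S.field (G y) (t y)) x := (hD k).sub
    (smoothNear_field hS hG ht)
  have hΘ : ∀ w, SmoothNear (fun y => S.F (G y) (t y) ⬝ᵥ fderiv ℝ G y w) x := fun w =>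
    (S.smoothNear_F hG ht).dotProduct (hD w)
  have hΛ : SmoothNear (fun y => S.F (G y) (t y) ⬝ᵥ fderiv ℝ G y k - S.B (G y) (t y)) x :=
    (hΘ k).sub (SmoothNear.comp (g := fun p : Phase n × ℝ => S.B p.1 p.2)
      (S.smooth_B.smoothNear _) (hG.prodMk ht))
  have hdd : ∀ {f : E → ℝ} (w : E), SmoothNear f x →
      DifferentiableAt ℝ (fun y => fderiv ℝ f y w) x := fun w hf =>
    (hf.fderiv.clm_apply (contDiff_const.smoothNear _)).differentiableAt
  have hswap : ∀ w w', (∀ y, fderiv ℝ t y w = 0) →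
      fderiv ℝ (fun y => fderiv ℝ (fun y => S.F (G y) (t y) ⬝ᵥ fderiv ℝ G y w) y w') x k =
        fderiv ℝ (fun y => fderiv ℝ
          (fun y => S.F (G y) (t y) ⬝ᵥ fderiv ℝ G y k - S.B (G y) (t y)) y w) x w' -
        fderiv ℝ (fun y => S.form (G y) (t y) (fderiv ℝ G y w)
          (fderiv ℝ G y k - S.field (G y) (t y))) x w' := by
    intro w w' hw
    have hcartan : (fun y => fderiv ℝ (fun y => S.F (G y) (t y) ⬝ᵥ fderiv ℝ G y w) y k) =ᶠ[𝓝 x]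
        fun y => fderiv ℝ (fun y => S.F (G y) (t y) ⬝ᵥ fderiv ℝ G y k - S.B (G y) (t y)) y w -
          S.form (G y) (t y) (fderiv ℝ G y w) (fderiv ℝ G y k - S.field (G y) (t y)) := by
      filter_upwards [hG.eventually, ht.eventually] with y hy hty
      exact fderiv_pullback hS hy hty (hw y) (hk y)
    rw [(hΘ w).fderiv_fderiv_comm, hcartan.fderiv_eq, fderiv_fun_sub (hdd w hΛ)
      (S.smoothNear_form hG ht (hD w) hdef).differentiableAt]
    rfl
  have hform : (fun y => S.form (G y) (t y) (fderiv ℝ G y u) (fderiv ℝ G y v)) =ᶠ[𝓝 x] fun y =>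
      fderiv ℝ (fun y => S.F (G y) (t y) ⬝ᵥ fderiv ℝ G y v) y u -
        fderiv ℝ (fun y => S.F (G y) (t y) ⬝ᵥ fderiv ℝ G y u) y v := by
    filter_upwards [hG.eventually, ht.eventually] with y hy hty
    exact (S.fderiv_pullback_sub hy hty (hu y) (hv y)).symm
  rw [hform.fderiv_eq, fderiv_fun_sub (hdd u (hΘ v)) (hdd v (hΘ u)), sub_apply, hswap v u hv,
    hswap u v hu, hΛ.fderiv_fderiv_comm u v]
  ring

end Pullback

/-- The final time `s + τ` of a map `G((z, s), τ)` which takes time `s` to time `s + τ`. -/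
theorem smoothNear_clock {E : Type*} [NormedAddCommGroup E] [NormedSpace ℝ E]
    (x : (E × ℝ) × ℝ) : SmoothNear (fun y : (E × ℝ) × ℝ => y.1.2 + y.2) x :=
  ContDiff.smoothNear (by fun_prop) x

theorem fderiv_clock {E : Type*} [NormedAddCommGroup E] [NormedSpace ℝ E]
    (x u : (E × ℝ) × ℝ) : fderiv ℝ (fun y : (E × ℝ) × ℝ => y.1.2 + y.2) x u = u.1.2 + u.2 := by
  have h : HasFDerivAt (fun y : (E × ℝ) × ℝ => y.1.2 + y.2)
      ((ContinuousLinearMap.snd ℝ E ℝ).comp (ContinuousLinearMap.fst ℝ (E × ℝ) ℝ) +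
        ContinuousLinearMap.snd ℝ (E × ℝ) ℝ) x :=
    ((ContinuousLinearMap.snd ℝ E ℝ).comp (ContinuousLinearMap.fst ℝ (E × ℝ) ℝ) +
        ContinuousLinearMap.snd ℝ (E × ℝ) ℝ).hasFDerivAt
  rw [h.fderiv]; rfl

variable {S}

/-- A smooth approximate flow with defect `O(τ^m)` is symplectic up to `O(τ^(m+1))`. -/
theorem isBigO_form_pullback_sub (hS : S.Regular) {G : (Phase n × ℝ) × ℝ → Phase n}
    {p₀ : Phase n × ℝ} {m : ℕ} (hG : SmoothNear G (p₀, 0))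
    (hG0 : ∀ᶠ p in 𝓝 p₀, G (p, 0) = p.1)
    (hdef : (fun x => fderiv ℝ G x (0, 1) - S.field (G x) (x.1.2 + x.2)) =O[𝓝 (p₀, 0)]
      fun x => x.2 ^ m) (u v : Phase n) :
    (fun x : (Phase n × ℝ) × ℝ => S.form (G x) (x.1.2 + x.2) (fderiv ℝ G x ((u, 0), 0))
      (fderiv ℝ G x ((v, 0), 0)) - S.form x.1.1 x.1.2 u v) =O[𝓝 (p₀, 0)]
      fun x => x.2 ^ (m + 1) := by
  set t : (Phase n × ℝ) × ℝ → ℝ := fun y => y.1.2 + y.2 with ht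
  have hts : ∀ x, SmoothNear t x := smoothNear_clock
  have hDs : ∀ w x, SmoothNear G x → SmoothNear (fun y => fderiv ℝ G y w) x := fun w x hx =>
    hx.fderiv.clm_apply (contDiff_const.smoothNear _)
  let defect : (Phase n × ℝ) × ℝ → Phase n := fun x => fderiv ℝ G x (0, 1) - S.field (G x) (t x)
  have hes : ∀ x, SmoothNear G x → SmoothNear defect x := fun x hx => (hDs _ x hx).sub
    (smoothNear_field hS hx (hts x))
  have htw : ∀ (w : Phase n) x, fderiv ℝ t x ((w, 0), 0) = 0 := fun w x => by
    rw [ht, fderiv_clock]; simp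
  have htk : ∀ x, fderiv ℝ t x (0, 1) = 1 := fun x => by rw [ht, fderiv_clock]; simp
  have hhO : ∀ w : Phase n, (fun y => S.form (G y) (t y) (fderiv ℝ G y ((w, 0), 0)) (defect y))
      =O[𝓝 (p₀, 0)] fun x => x.2 ^ m := by
    intro w
    have hA := (S.smoothNear_fderiv_F hG (hts _))
    have h1 := isBigO_dotProduct (hA.clm_apply (hDs ((w, 0), 0) _ hG)).continuousAt hdef
    have h2 := isBigO_dotProduct (hDs ((w, 0), 0) _ hG).continuousAt
      (isBigO_clm_apply hA.continuousAt hdef)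
    refine (h1.sub h2).congr_left fun x => ?_
    simp only [form, defect, ht, dotProduct_comm]
  have hhs : ∀ w : Phase n, SmoothNear
      (fun y => S.form (G y) (t y) (fderiv ℝ G y ((w, 0), 0)) (defect y)) (p₀, 0) := fun w =>
    S.smoothNear_form hG (hts _) (hDs _ _ hG) (hes _ hG)
  have hconst : ∀ x, SmoothNear (fun y : (Phase n × ℝ) × ℝ => S.form y.1.1 y.1.2 u v) x := fun x =>
    S.smoothNear_form (ContDiff.smoothNear (by fun_prop) _) (ContDiff.smoothNear (by fun_prop) _)
      (contDiff_const.smoothNear _) (contDiff_const.smoothNear _)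
  have hsm : SmoothNear (fun x : (Phase n × ℝ) × ℝ => S.form (G x) (t x)
      (fderiv ℝ G x ((u, 0), 0)) (fderiv ℝ G x ((v, 0), 0)) - S.form x.1.1 x.1.2 u v) (p₀, 0) :=
    (S.smoothNear_form hG (hts _) (hDs _ _ hG) (hDs _ _ hG)).sub (hconst _)
  refine isBigO_pow_succ_of_timeDeriv hsm ?_ ?_
  · filter_upwards [hG0.eventually_nhds, (tendsto_prodMk_zero p₀).eventually hG.eventually]
      with p hp hp'
    have h1 : ∀ w : Phase n, fderiv ℝ G (p, 0) ((w, 0), 0) = w := by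
      intro w
      have h2 : (fun q => G (q, 0)) =ᶠ[𝓝 p] Prod.fst := hp
      rw [← fderiv_partial_left hp'.differentiableAt, h2.fderiv_eq, fderiv_fst]
      rfl
    simp only [h1, hp.self_of_nhds, add_zero, sub_self]
  · have hO := ((hhs u).isBigO_fderiv (hhO u) (v, 0)).sub ((hhs v).isBigO_fderiv (hhO v) (u, 0))
    refine hO.congr' ?_ EventuallyEq.rfl
    filter_upwards [hG.eventually, hsm.timeDeriv_eventuallyEq] with x hx hx2
    have hk : fderiv ℝ (fun y : (Phase n × ℝ) × ℝ => S.form y.1.1 y.1.2 u v) x (0, 1) = 0 := by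
      rw [← timeDeriv_eq (hconst x).differentiableAt]
      exact deriv_const x.2 (S.form x.1.1 x.1.2 u v)
    rw [hx2, fderiv_fun_sub (S.smoothNear_form hx (hts _) (hDs _ _ hx) (hDs _ _ hx)).differentiableAt
      (hconst x).differentiableAt, sub_apply, hk, sub_zero,
      fderiv_form_pullback hS hx (hts x) (htw u) (htw v) htk]

end System

/-! ### The Jacobian of the transformation -/

namespace Transformation

variable {n : ℕ} (α : Transformation n)

theorem contDiff_slice (t s : ℝ) : ContDiff ℝ ∞ (α.map t s) :=
  α.smooth_map.comp (f := fun q => (q, t, s)) (by fun_prop)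

theorem differentiableAt_slice (t s : ℝ) (q : Phase n × Phase n) :
    DifferentiableAt ℝ (α.map t s) q :=
  (α.contDiff_slice t s).differentiable (by simp) q

theorem fderiv_injective (t s : ℝ) (q : Phase n × Phase n) :
    Function.Injective (fderiv ℝ (α.map t s) q) := by
  have h1 : ContDiff ℝ ∞ (α.map t s).symm :=
    α.smooth_symm.comp (f := fun q => (q, t, s)) (by fun_prop)
  have h2 : HasFDerivAt ((α.map t s).symm ∘ α.map t s) _ q :=
    (h1.differentiable (by simp) _).hasFDerivAt.comp q (α.differentiableAt_slice t s q).hasFDerivAt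
  rw [Equiv.symm_comp_self] at h2
  have h3 := h2.unique (hasFDerivAt_id q)
  intro x y hxy
  have h4 := congrArg (fun L => L x) h3
  have h5 := congrArg (fun L => L y) h3
  simp only [ContinuousLinearMap.comp_apply, ContinuousLinearMap.id_apply] at h4 h5
  rw [← h4, ← h5, hxy]

theorem A_mulVec (zh z : Phase n) (t s : ℝ) (u : Phase n) :
    (α.A zh z t s).mulVec u = (fderiv ℝ (α.map t s) (zh, z) (u, 0)).1 := by
  rw [A, jacobian_mulVec]
  have h := α.differentiableAt_slice t s (zh, z)
  have h1 := fderiv_partial_left (f := fun q => (α.map t s q).1) h.fst u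
  rw [fderiv.fst h] at h1
  exact h1

theorem B_mulVec (zh z : Phase n) (t s : ℝ) (u : Phase n) :
    (α.B zh z t s).mulVec u = (fderiv ℝ (α.map t s) (zh, z) (0, u)).1 := by
  rw [B, jacobian_mulVec]
  have h := α.differentiableAt_slice t s (zh, z)
  have h1 := fderiv_partial_right (f := fun q => (α.map t s q).1) h.fst u
  rw [fderiv.fst h] at h1
  exact h1

theorem C_mulVec (zh z : Phase n) (t s : ℝ) (u : Phase n) :
    (α.C zh z t s).mulVec u = (fderiv ℝ (α.map t s) (zh, z) (u, 0)).2 := by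
  rw [C, jacobian_mulVec]
  have h := α.differentiableAt_slice t s (zh, z)
  have h1 := fderiv_partial_left (f := fun q => (α.map t s q).2) h.snd u
  rw [fderiv.snd h] at h1
  exact h1

theorem D_mulVec (zh z : Phase n) (t s : ℝ) (u : Phase n) :
    (α.D zh z t s).mulVec u = (fderiv ℝ (α.map t s) (zh, z) (0, u)).2 := by
  rw [D, jacobian_mulVec]
  have h := α.differentiableAt_slice t s (zh, z)
  have h1 := fderiv_partial_right (f := fun q => (α.map t s q).2) h.snd u
  rw [fderiv.snd h] at h1
  exact h1

theorem jac_mulVec (zh z : Phase n) (t s : ℝ) (x : Phase n × Phase n) :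
    (α.jac zh z t s).mulVec (Sum.elim x.1 x.2) =
      Sum.elim (fderiv ℝ (α.map t s) (zh, z) x).1 (fderiv ℝ (α.map t s) (zh, z) x).2 := by
  have hx : x = (x.1, 0) + (0, x.2) := by simp
  rw [jac, Matrix.fromBlocks_mulVec]
  simp only [Sum.elim_comp_inl, Sum.elim_comp_inr, A_mulVec, B_mulVec,
    C_mulVec, D_mulVec]
  rw [← Prod.fst_add, ← Prod.snd_add, ← map_add, ← hx]

variable {α}

/-- Adaptedness as an identity of bilinear forms: the transformation pulls the canonical form back
to the difference of the two-forms of the system at the two times. -/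
theorem IsAdapted.form_eq {S : System n} (hα : α.IsAdapted S) (zh z : Phase n) (t s : ℝ)
    (x y : Phase n × Phase n) :
    (fderiv ℝ (α.map t s) (zh, z) x).1 ⬝ᵥ (fderiv ℝ (α.map t s) (zh, z) y).2 -
      (fderiv ℝ (α.map t s) (zh, z) x).2 ⬝ᵥ (fderiv ℝ (α.map t s) (zh, z) y).1 =
      S.form zh t x.1 y.1 - S.form z s x.2 y.2 := by
  have h := congrArg (fun M => Sum.elim x.1 x.2 ⬝ᵥ M.mulVec (Sum.elim y.1 y.2)) (hα zh z t s)
  simp only [← Matrix.mulVec_mulVec, Matrix.mulVec_transpose, jac_mulVec, J4,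
    Matrix.fromBlocks_mulVec, Sum.elim_comp_inl, Sum.elim_comp_inr, Matrix.zero_mulVec,
    Matrix.one_mulVec, Matrix.neg_mulVec, zero_add, add_zero] at h
  rw [dotProduct_comm, ← Matrix.dotProduct_mulVec, jac_mulVec, dotProduct_comm] at h
  simp only [sumElim_dotProduct_sumElim, dotProduct_neg,
    System.dotProduct_K_mulVec] at h
  linarith

end Transformation

/-! ### The truncated series and its residual -/

section Series

variable {n : ℕ} (S : System n) (α : Transformation n) (φ₀ : Phase n → ℝ → Phase n)

/-- The truncated series as a function of `((w, s), τ)`, where `t = s + τ`. -/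
def series (m : ℕ) (x : (Phase n × ℝ) × ℝ) : Phase n :=
  ∑ i ∈ Finset.range (m + 1), x.2 ^ i • coeff S α φ₀ i x.1.1 x.1.2

/-- The derivative of the truncated series in `w`. -/
def seriesDeriv (m : ℕ) (x : (Phase n × ℝ) × ℝ) : Phase n →L[ℝ] Phase n :=
  ∑ i ∈ Finset.range (m + 1), x.2 ^ i • fderiv ℝ (fun w' => coeff S α φ₀ i w' x.1.2) x.1.1

/-- The right-hand side of the equation of the generating function along the truncated series. -/
def seriesRhs (m : ℕ) (x : (Phase n × ℝ) × ℝ) : Phase n :=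
  rhs S α (series S α φ₀ m x) x.1.1 (seriesDeriv S α φ₀ m x) (x.1.2 + x.2) x.1.2

theorem truncated_eq_series (m : ℕ) (w : Phase n) (t s : ℝ) :
    truncated S α φ₀ m w t s = series S α φ₀ m ((w, s), t - s) := rfl

theorem iteratedDeriv_eq_comp_add {F : Type*} [NormedAddCommGroup F] [NormedSpace ℝ F] (k : ℕ)
    (f : ℝ → F) (s : ℝ) : iteratedDeriv k f s = iteratedDeriv k (fun τ => f (s + τ)) 0 := by
  rw [iteratedDeriv_comp_const_add]
  simp only [add_zero]

theorem coeff_succ (k : ℕ) (w : Phase n) (s : ℝ) :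
    coeff S α φ₀ (k + 1) w s = (((k + 1)! : ℕ) : ℝ)⁻¹ •
      iteratedDeriv k (fun τ => seriesRhs S α φ₀ k ((w, s), τ)) 0 := by
  rw [coeff]
  beta_reduce
  rw [iteratedDeriv_eq_comp_add k _ s]
  refine congrArg (fun f : ℝ → Phase n => (((k + 1)! : ℕ) : ℝ)⁻¹ • iteratedDeriv k f 0) (funext fun τ => ?_)
  rw [seriesRhs, series, seriesDeriv, add_sub_cancel_left,
    Fin.sum_univ_eq_sum_range (fun i => τ ^ i • coeff S α φ₀ i w s) (k + 1),
    Fin.sum_univ_eq_sum_range (fun i => τ ^ i • fderiv ℝ (fun w' => coeff S α φ₀ i w' s) w) (k + 1)]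

theorem coeff_zero : coeff S α φ₀ 0 = φ₀ := by rw [coeff]

variable {S α φ₀}

theorem smoothNear_pow_smul {F : Type*} [NormedAddCommGroup F] [NormedSpace ℝ F]
    {c : Phase n × ℝ → F} {p : Phase n × ℝ} (hc : SmoothNear c p) (i : ℕ) (τ : ℝ) :
    SmoothNear (fun x : (Phase n × ℝ) × ℝ => x.2 ^ i • c x.1) (p, τ) :=
  SmoothNear.smul (ContDiff.smoothNear (by fun_prop) _)
    (SmoothNear.comp (g := c) (f := Prod.fst) hc (contDiff_fst.smoothNear _))

theorem smoothNear_series {m : ℕ} {p : Phase n × ℝ}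
    (hc : ∀ i ≤ m, SmoothNear (fun q : Phase n × ℝ => coeff S α φ₀ i q.1 q.2) p) (τ : ℝ) :
    SmoothNear (series S α φ₀ m) (p, τ) :=
  SmoothNear.sum fun i hi => smoothNear_pow_smul (hc i (by simp at hi; omega)) i τ

theorem smoothNear_partialDeriv {F : Type*} [NormedAddCommGroup F] [NormedSpace ℝ F]
    {c : Phase n → ℝ → F} {p : Phase n × ℝ}
    (hc : SmoothNear (fun q : Phase n × ℝ => c q.1 q.2) p) :
    SmoothNear (fun q : Phase n × ℝ => fderiv ℝ (fun w' => c w' q.2) q.1) p := by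
  refine SmoothNear.fderiv_comp (f := fun (q : Phase n × ℝ) w' => c w' q.2) ?_
    (contDiff_fst.smoothNear _)
  exact SmoothNear.comp (g := fun q : Phase n × ℝ => c q.1 q.2)
    (f := fun x : (Phase n × ℝ) × Phase n => (x.2, x.1.2)) hc (ContDiff.smoothNear (by fun_prop) _)

theorem smoothNear_seriesDeriv {m : ℕ} {p : Phase n × ℝ}
    (hc : ∀ i ≤ m, SmoothNear (fun q : Phase n × ℝ => coeff S α φ₀ i q.1 q.2) p) (τ : ℝ) :
    SmoothNear (seriesDeriv S α φ₀ m) (p, τ) :=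
  SmoothNear.sum fun i hi =>
    smoothNear_pow_smul (smoothNear_partialDeriv (hc i (by simp at hi; omega))) i τ

/-- The right-hand side `𝒜` as a function of a single variable. -/
def rhsFun (S : System n) (α : Transformation n)
    (p : Phase n × Phase n × (Phase n →L[ℝ] Phase n) × ℝ × ℝ) : Phase n :=
  rhs S α p.1 p.2.1 p.2.2.1 p.2.2.2.1 p.2.2.2.2

theorem smoothNear_seriesRhs (hA : ContDiff ℝ ∞ (rhsFun S α)) {m : ℕ} {p : Phase n × ℝ}
    (hc : ∀ i ≤ m, SmoothNear (fun q : Phase n × ℝ => coeff S α φ₀ i q.1 q.2) p) (τ : ℝ) :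
    SmoothNear (seriesRhs S α φ₀ m) (p, τ) :=
  SmoothNear.comp (g := rhsFun S α) (f := fun x => (series S α φ₀ m x, x.1.1,
      seriesDeriv S α φ₀ m x, x.1.2 + x.2, x.1.2)) (hA.smoothNear _)
    ((smoothNear_series hc τ).prodMk ((ContDiff.smoothNear (by fun_prop) _).prodMk
      ((smoothNear_seriesDeriv hc τ).prodMk (ContDiff.smoothNear (by fun_prop) _))))

theorem smoothNear_coeff (hA : ContDiff ℝ ∞ (rhsFun S α)) {p : Phase n × ℝ}
    (h0 : SmoothNear (fun q : Phase n × ℝ => φ₀ q.1 q.2) p) (k : ℕ) :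
    SmoothNear (fun q : Phase n × ℝ => coeff S α φ₀ k q.1 q.2) p := by
  induction k using Nat.strong_induction_on with
  | _ k ih =>
    cases k with
    | zero => simpa only [coeff_zero] using h0
    | succ k =>
      have h1 := (smoothNear_seriesRhs (m := k) hA (fun i hi => ih i (by omega)) 0).iteratedDeriv k
      have h2 : SmoothNear (fun q : Phase n × ℝ =>
          iteratedDeriv k (fun τ => seriesRhs S α φ₀ k (q, τ)) 0) p :=
        SmoothNear.comp (g := fun x : (Phase n × ℝ) × ℝ =>
          iteratedDeriv k (fun τ => seriesRhs S α φ₀ k (x.1, τ)) x.2) (f := fun q => (q, (0 : ℝ)))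
          h1 (ContDiff.smoothNear (by fun_prop) _)
      simp only [coeff_succ]
      exact SmoothNear.smul (contDiff_const.smoothNear _) h2

theorem sum_range_sub_isBigO {F : Type*} [NormedAddCommGroup F] [NormedSpace ℝ F] (a : ℕ → F)
    {i m : ℕ} (hi : i ≤ m) :
    (fun τ : ℝ => ∑ j ∈ Finset.range (m + 1), τ ^ j • a j - ∑ j ∈ Finset.range (i + 1), τ ^ j • a j)
      =O[𝓝 0] fun τ => τ ^ (i + 1) := by
  simp only [← Finset.sum_Ico_eq_sub _ (by omega : i + 1 ≤ m + 1)]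
  refine Asymptotics.IsBigO.fun_sum fun j hj => ?_
  have hj' := (Finset.mem_Ico.1 hj).1
  have h1 : (fun τ : ℝ => τ ^ j) =O[𝓝 0] fun τ => τ ^ (i + 1) := by
    have h := (Asymptotics.isBigO_refl (fun τ : ℝ => τ ^ (i + 1)) (𝓝 0)).mul
      ((by fun_prop : Continuous fun τ : ℝ => τ ^ (j - (i + 1))).continuousAt.isBigO_one ℝ)
    simpa only [← pow_add, Nat.add_sub_cancel' hj', mul_one] using h
  have h2 : (fun _ : ℝ => a j) =O[𝓝 0] fun _ => (1 : ℝ) := Asymptotics.isBigO_const_const _ (by simp) _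
  simpa using h1.smul h2

/-- Only the terms of order at most `i` of the series enter the `i`-th derivative of the right-hand
side. -/
theorem iteratedDeriv_seriesRhs (hA : ContDiff ℝ ∞ (rhsFun S α)) {p : Phase n × ℝ} {i m : ℕ}
    (hc : ∀ i ≤ m, SmoothNear (fun q : Phase n × ℝ => coeff S α φ₀ i q.1 q.2) p) (hi : i ≤ m) :
    iteratedDeriv i (fun τ => seriesRhs S α φ₀ m (p, τ)) 0 =
      iteratedDeriv i (fun τ => seriesRhs S α φ₀ i (p, τ)) 0 := by
  let γ : ℕ → ℝ → Phase n × Phase n × (Phase n →L[ℝ] Phase n) × ℝ × ℝ := fun k τ =>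
    (series S α φ₀ k (p, τ), p.1, seriesDeriv S α φ₀ k (p, τ), p.2 + τ, p.2)
  have hγc : ∀ k, Continuous (γ k) := fun k => by
    simp only [γ, series, seriesDeriv]; fun_prop
  have hγ0 : γ i 0 = γ m 0 := by
    have h : ∀ k, γ k 0 = (coeff S α φ₀ 0 p.1 p.2, p.1,
        fderiv ℝ (fun w' => coeff S α φ₀ 0 w' p.2) p.1, p.2 + 0, p.2) := by
      intro k
      simp only [γ, series, seriesDeriv, Finset.sum_range_succ' _ k]
      simp
    rw [h, h]
  have hγO : (fun τ => γ m τ - γ i τ) =O[𝓝 0] fun τ : ℝ => τ ^ (i + 1) := by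
    have h1 := sum_range_sub_isBigO (fun j => coeff S α φ₀ j p.1 p.2) hi
    have h2 := sum_range_sub_isBigO (fun j => fderiv ℝ (fun w' => coeff S α φ₀ j w' p.2) p.1) hi
    refine (h1.prod_left ((Asymptotics.isBigO_zero _ _).prod_left (h2.prod_left
      ((Asymptotics.isBigO_zero _ _).prod_left (Asymptotics.isBigO_zero _ _))))).congr_left
      fun τ => ?_
    simp only [γ, series, seriesDeriv, Prod.mk_sub_mk, sub_self, Prod.mk_zero_zero]
  have hstrict : HasStrictFDerivAt (rhsFun S α) (fderiv ℝ (rhsFun S α) (γ m 0)) (γ m 0) :=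
    hA.contDiffAt.hasStrictFDerivAt (by simp)
  have hlim : Tendsto (fun τ => (γ m τ, γ i τ)) (𝓝 0) (𝓝 (γ m 0, γ m 0)) := by
    have h := ((hγc m).prodMk (hγc i)).tendsto 0
    rwa [hγ0] at h
  have hO : (fun τ => seriesRhs S α φ₀ m (p, τ) - seriesRhs S α φ₀ i (p, τ)) =O[𝓝 0]
      fun τ => τ ^ (i + 1) := (hstrict.isBigO_sub.comp_tendsto hlim).trans hγO
  have hsm : ∀ k ≤ m, SmoothNear (fun τ => seriesRhs S α φ₀ k (p, τ)) 0 := fun k hk =>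
    SmoothNear.comp (g := seriesRhs S α φ₀ k) (f := fun τ : ℝ => (p, τ))
      (smoothNear_seriesRhs hA (fun j hj => hc j (by omega)) 0) (ContDiff.smoothNear (by fun_prop) _)
  have h1 := iteratedDeriv_eq_zero_of_isBigO ((hsm m le_rfl).sub (hsm i hi)) hO i (by omega)
  have h2 := iteratedDeriv_sub (n := i) ((hsm m le_rfl).contDiffAt.of_le (by exact_mod_cast le_top))
    ((hsm i hi).contDiffAt.of_le (by exact_mod_cast le_top))
  exact sub_eq_zero.1 (h2.symm.trans h1)

/-- The truncated series solves the equation of the generating function up to `O(τ^m)`. -/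
theorem residual_isBigO (hA : ContDiff ℝ ∞ (rhsFun S α)) {p₀ : Phase n × ℝ} (m : ℕ)
    (h0 : SmoothNear (fun q : Phase n × ℝ => φ₀ q.1 q.2) p₀) :
    (fun x => timeDeriv (series S α φ₀ m) x - seriesRhs S α φ₀ m x) =O[𝓝 (p₀, 0)]
      fun x => x.2 ^ m := by
  have hc := fun i => smoothNear_coeff hA h0 i
  have hs := smoothNear_series (m := m) (fun i _ => hc i) 0
  refine isBigO_pow_of_iteratedDeriv
    (hs.timeDeriv.sub (smoothNear_seriesRhs hA (fun i _ => hc i) 0)) fun i hi => ?_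
  filter_upwards [eventually_all_finset (Finset.range (m + 1)) |>.2 fun j _ => (hc j).eventually]
    with p hp
  have hp' : ∀ j ≤ m, SmoothNear (fun q : Phase n × ℝ => coeff S α φ₀ j q.1 q.2) p :=
    fun j hj => hp j (by simp; omega)
  have hlift : SmoothNear (fun τ : ℝ => (p, τ)) 0 := ContDiff.smoothNear (by fun_prop) _
  have hd1 : SmoothNear (fun τ => timeDeriv (series S α φ₀ m) (p, τ)) 0 :=
    SmoothNear.comp (g := timeDeriv (series S α φ₀ m)) (smoothNear_series hp' 0).timeDeriv hlift
  have hd2 : SmoothNear (fun τ => seriesRhs S α φ₀ m (p, τ)) 0 :=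
    SmoothNear.comp (g := seriesRhs S α φ₀ m) (smoothNear_seriesRhs hA hp' 0) hlift
  have h1 := iteratedDeriv_sub (n := i) (hd1.contDiffAt.of_le (by exact_mod_cast le_top))
    (hd2.contDiffAt.of_le (by exact_mod_cast le_top))
  refine h1.trans ?_
  rw [iteratedDeriv_seriesRhs hA hp' hi.le]
  have h2 : iteratedDeriv i (fun τ => timeDeriv (series S α φ₀ m) (p, τ)) 0 =
      iteratedDeriv (i + 1) (fun τ => series S α φ₀ m (p, τ)) 0 := by
    rw [iteratedDeriv_succ']; rfl
  rw [h2]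
  simp only [series]
  rw [iteratedDeriv_sum_pow_smul (fun j => coeff S α φ₀ j p.1 p.2) (by omega : i + 1 ≤ m),
    coeff_succ, smul_smul, mul_inv_cancel₀ (by positivity), one_smul, sub_self]

theorem series_zero (m : ℕ) (p : Phase n × ℝ) : series S α φ₀ m (p, 0) = φ₀ p.1 p.2 := by
  simp [series, Finset.sum_range_succ' _ m, coeff_zero]

theorem fderiv_series_slice {m : ℕ} {p : Phase n × ℝ}
    (hc : ∀ i ≤ m, SmoothNear (fun q : Phase n × ℝ => coeff S α φ₀ i q.1 q.2) p) (τ : ℝ) :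
    HasFDerivAt (fun w => series S α φ₀ m ((w, p.2), τ)) (seriesDeriv S α φ₀ m (p, τ)) p.1 := by
  refine HasFDerivAt.fun_sum fun i hi => ?_
  have h1 : DifferentiableAt ℝ (fun w' => coeff S α φ₀ i w' p.2) p.1 :=
    (SmoothNear.comp (g := fun q : Phase n × ℝ => coeff S α φ₀ i q.1 q.2)
      (f := fun w' => (w', p.2)) (hc i (by simp at hi; omega))
      (ContDiff.smoothNear (by fun_prop) _)).differentiableAt
  exact h1.hasFDerivAt.fun_const_smul (τ ^ i)

theorem fderiv_series {m : ℕ} {p : Phase n × ℝ}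
    (hc : ∀ i ≤ m, SmoothNear (fun q : Phase n × ℝ => coeff S α φ₀ i q.1 q.2) p) (τ : ℝ)
    (a : Phase n) (b : ℝ) : fderiv ℝ (series S α φ₀ m) (p, τ) ((a, 0), b) =
      seriesDeriv S α φ₀ m (p, τ) a + b • timeDeriv (series S α φ₀ m) (p, τ) := by
  have hd := (smoothNear_series (m := m) hc τ).differentiableAt
  have hd' : DifferentiableAt ℝ (fun q => series S α φ₀ m (q, τ)) p :=
    hd.comp p (f := fun q => (q, τ)) (by fun_prop)
  have h1 := fderiv_partial_left (a := p.1) (b := p.2) hd' a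
  rw [(fderiv_series_slice hc τ).fderiv, fderiv_partial_left hd] at h1
  rw [h1, timeDeriv_eq hd, ← map_smul, ← map_add]
  simp

end Series

/-! ### The initial gradient map -/

section Initial

variable {n : ℕ} {S : System n} {α : Transformation n} {φ₀ : Phase n → ℝ → Phase n}
  {z₀ : Phase n} {t₀ : ℝ}

namespace Transformation

variable {E : Type*} [NormedAddCommGroup E] [NormedSpace ℝ E]

theorem smoothNear_map (α : Transformation n) {q : E → Phase n × Phase n} {t s : E → ℝ} {x : E}
    (hq : SmoothNear q x) (ht : SmoothNear t x) (hs : SmoothNear s x) :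
    SmoothNear (fun y => α.map (t y) (s y) (q y)) x :=
  SmoothNear.comp (g := fun p : (Phase n × Phase n) × ℝ × ℝ => α.map p.2.1 p.2.2 p.1)
    (f := fun y => (q y, t y, s y)) (α.smooth_map.smoothNear _) (hq.prodMk (ht.prodMk hs))

theorem smoothNear_fderiv_map (α : Transformation n) {q : E → Phase n × Phase n} {t s : E → ℝ}
    {x : E} (hq : SmoothNear q x) (ht : SmoothNear t x) (hs : SmoothNear s x) :
    SmoothNear (fun y => fderiv ℝ (α.map (t y) (s y)) (q y)) x := by
  refine SmoothNear.fderiv_comp (f := fun y => α.map (t y) (s y)) ?_ hq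
  exact α.smoothNear_map (q := Prod.snd) (t := fun p : E × Phase n × Phase n => t p.1)
    (s := fun p => s p.1) (contDiff_snd.smoothNear _)
    (SmoothNear.comp (g := t) (f := Prod.fst) ht (contDiff_fst.smoothNear _))
    (SmoothNear.comp (g := s) (f := Prod.fst) hs (contDiff_fst.smoothNear _))

/-- The chain rule in a direction `u` along which the initial time `s` is constant. -/
theorem fderiv_map_comp (α : Transformation n) {q : E → Phase n × Phase n} {t s : E → ℝ} {x : E}
    (hq : DifferentiableAt ℝ q x) (ht : DifferentiableAt ℝ t x) (hs : DifferentiableAt ℝ s x)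
    {u : E} (hu : fderiv ℝ s x u = 0) :
    fderiv ℝ (fun y => α.map (t y) (s y) (q y)) x u =
      fderiv ℝ (α.map (t x) (s x)) (q x) (fderiv ℝ q x u) +
        fderiv ℝ t x u • deriv (fun t' => α.map t' (s x) (q x)) (t x) := by
  have hM : DifferentiableAt ℝ
      (fun p : (Phase n × Phase n) × ℝ × ℝ => α.map p.2.1 p.2.2 p.1) (q x, t x, s x) :=
    α.smooth_map.differentiable (by simp) _
  have h1 : fderiv ℝ (fun y => α.map (t y) (s y) (q y)) x = _ :=
    (hM.hasFDerivAt.comp x (f := fun y => (q y, t y, s y))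
      (hq.hasFDerivAt.prodMk (ht.hasFDerivAt.prodMk hs.hasFDerivAt))).fderiv
  rw [h1]
  simp only [ContinuousLinearMap.comp_apply, ContinuousLinearMap.prod_apply, hu]
  have h2 : DifferentiableAt ℝ (fun p : (Phase n × Phase n) × ℝ => α.map p.2 (s x) p.1)
      (q x, t x) :=
    hM.comp (q x, t x) (f := fun p : (Phase n × Phase n) × ℝ => (p.1, p.2, s x)) (by fun_prop)
  have h3 := fderiv_uncurry (f := fun q' t' => α.map t' (s x) q') h2 (fderiv ℝ q x u)
    (fderiv ℝ t x u)
  rw [← h3]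
  have h4 : HasFDerivAt (fun p : (Phase n × Phase n) × ℝ => (p.1, p.2, s x))
      ((ContinuousLinearMap.fst ℝ (Phase n × Phase n) ℝ).prod
        ((ContinuousLinearMap.snd ℝ (Phase n × Phase n) ℝ).prod 0)) (q x, t x) :=
    hasFDerivAt_fst.prodMk (hasFDerivAt_snd.prodMk (hasFDerivAt_const _ _))
  have h5 : fderiv ℝ (fun p : (Phase n × Phase n) × ℝ => α.map p.2 (s x) p.1) (q x, t x) = _ :=
    (hM.hasFDerivAt.comp (q x, t x) (f := fun p : (Phase n × Phase n) × ℝ => (p.1, p.2, s x))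
      h4).fderiv
  rw [h5]
  rfl

/-- Transversality: the second component restricted to the diagonal is an immersion. -/
theorem IsTransversal.eq_zero (htr : α.IsTransversal z₀ t₀) {v : Phase n}
    (h : (fderiv ℝ (α.map t₀ t₀) (z₀, z₀) (v, v)).2 = 0) : v = 0 := by
  refine Matrix.eq_zero_of_mulVec_eq_zero htr ?_
  rw [Matrix.add_mulVec, C_mulVec, D_mulVec, ← Prod.snd_add, ← map_add]
  simpa using h

theorem IsTransversal.exists_eq (htr : α.IsTransversal z₀ t₀) (w : Phase n) :
    ∃ u, (fderiv ℝ (α.map t₀ t₀) (z₀, z₀) (u, u)).2 = w := by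
  obtain ⟨u, hu⟩ := (Matrix.mulVec_surjective_iff_isUnit.2
    ((Matrix.isUnit_iff_isUnit_det _).2 htr.isUnit)) w
  refine ⟨u, ?_⟩
  rw [← hu, Matrix.add_mulVec, C_mulVec, D_mulVec, ← Prod.snd_add, ← map_add]
  simp

end Transformation

/-- The derivative of `z ↦ α(z, z)`. -/
theorem fderiv_map_diag (α : Transformation n) (z : Phase n) (t s : ℝ) (v : Phase n) :
    fderiv ℝ (fun z' => α.map t s (z', z')) z v = fderiv ℝ (α.map t s) (z, z) (v, v) := by
  have h : fderiv ℝ (fun z' => α.map t s (z', z')) z = _ :=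
    ((α.differentiableAt_slice t s (z, z)).hasFDerivAt.comp z (f := fun z' => (z', z'))
      ((hasFDerivAt_id z).prodMk (hasFDerivAt_id z))).fderiv
  rw [h]; rfl

/-- Near a transversal point the diagonal at time `s` is parametrized by `w = α₂(z,z,s,s)`. -/
theorem exists_diagonal_parametrization (htr : α.IsTransversal z₀ t₀) :
    ∃ ζ : Phase n × ℝ → Phase n, SmoothNear ζ (α.two z₀ z₀ t₀ t₀, t₀) ∧
      ζ (α.two z₀ z₀ t₀ t₀, t₀) = z₀ ∧
      (∀ᶠ p in 𝓝 (α.two z₀ z₀ t₀ t₀, t₀), α.two (ζ p) (ζ p) p.2 p.2 = p.1) ∧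
      ∀ᶠ p : Phase n × ℝ in 𝓝 (z₀, t₀), ζ (α.two p.1 p.1 p.2 p.2, p.2) = p.1 := by
  let H : Phase n × (Phase n × ℝ) → Phase n := fun x => α.two x.1 x.1 x.2.2 x.2.2 - x.2.1
  have htwo : ∀ x, SmoothNear (fun x : Phase n × (Phase n × ℝ) =>
      α.two x.1 x.1 x.2.2 x.2.2) x := fun x =>
    SmoothNear.comp (g := Prod.snd) (contDiff_snd.smoothNear _)
      (α.smoothNear_map (q := fun x : Phase n × (Phase n × ℝ) => (x.1, x.1))
        (t := fun x => x.2.2) (s := fun x => x.2.2) (ContDiff.smoothNear (by fun_prop) _)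
        (ContDiff.smoothNear (by fun_prop) _) (ContDiff.smoothNear (by fun_prop) _))
  have hH : ∀ x, SmoothNear H x := fun x => (htwo x).sub (ContDiff.smoothNear (by fun_prop) _)
  obtain ⟨ζ, hζ, hζ0, V, hV, hz₀V, hmem⟩ := exists_implicit (H := H) (a₀ := z₀)
    (b₀ := (α.two z₀ z₀ t₀ t₀, t₀)) (hH _) (sub_self _) (by
      intro v hv
      rw [← fderiv_partial_left (hH _).differentiableAt] at hv
      simp only [H, fderiv_sub_const] at hv
      have hd : DifferentiableAt ℝ (fun z' => α.map t₀ t₀ (z', z')) z₀ :=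
        (α.differentiableAt_slice t₀ t₀ (z₀, z₀)).comp z₀ (f := fun z' => (z', z')) (by fun_prop)
      refine htr.eq_zero ?_
      rw [← fderiv_map_diag]
      have h1 := fderiv.snd hd
      rw [show (fun x => α.two x x t₀ t₀) = fun x => (α.map t₀ t₀ (x, x)).2 from rfl, h1] at hv
      exact hv)
  refine ⟨ζ, hζ, hζ0, ?_, ?_⟩
  · filter_upwards [hmem] with p hp
    exact sub_eq_zero.1 ((hp.2 _ hp.1).2 rfl)
  · have hlim : ContinuousAt (fun p : Phase n × ℝ => (α.two p.1 p.1 p.2 p.2, p.2)) (z₀, t₀) :=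
      (SmoothNear.comp (g := fun x : Phase n × (Phase n × ℝ) => α.two x.1 x.1 x.2.2 x.2.2)
        (f := fun p : Phase n × ℝ => (p.1, p)) (htwo _)
        (ContDiff.smoothNear (by fun_prop) _)).continuousAt.prodMk continuousAt_snd
    filter_upwards [hlim.eventually hmem,
      (continuousAt_fst (p := (z₀, t₀))).eventually (hV.mem_nhds hz₀V)] with p hp hpV
    exact ((hp.2 p.1 hpV).1 (sub_self _)).symm

theorem exists_isInitialGradientMap (htr : α.IsTransversal z₀ t₀) :
    ∃ φ₀, IsInitialGradientMap α z₀ t₀ φ₀ := by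
  obtain ⟨ζ, -, -, -, h⟩ := exists_diagonal_parametrization htr
  refine ⟨fun w s => α.one (ζ (w, s)) (ζ (w, s)) s s, ?_⟩
  filter_upwards [h] with p hp
  rw [hp]

theorem IsInitialGradientMap.smoothNear (h : IsInitialGradientMap α z₀ t₀ φ₀)
    (htr : α.IsTransversal z₀ t₀) :
    SmoothNear (fun q : Phase n × ℝ => φ₀ q.1 q.2) (α.two z₀ z₀ t₀ t₀, t₀) := by
  obtain ⟨ζ, hζ, hζ0, hζ1, -⟩ := exists_diagonal_parametrization htr
  have h1 : SmoothNear (fun q : Phase n × ℝ => α.one (ζ q) (ζ q) q.2 q.2)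
      (α.two z₀ z₀ t₀ t₀, t₀) :=
    SmoothNear.comp (g := Prod.fst) (contDiff_fst.smoothNear _)
      (α.smoothNear_map (q := fun q => (ζ q, ζ q)) (t := Prod.snd) (s := Prod.snd)
        (hζ.prodMk hζ) (contDiff_snd.smoothNear _) (contDiff_snd.smoothNear _))
  have hlim : Tendsto (fun q : Phase n × ℝ => (ζ q, q.2)) (𝓝 (α.two z₀ z₀ t₀ t₀, t₀))
      (𝓝 (z₀, t₀)) := by
    have := hζ.continuousAt.prodMk (continuousAt_snd (p := (α.two z₀ z₀ t₀ t₀, t₀)))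
    rwa [ContinuousAt, hζ0] at this
  refine h1.congr ?_
  filter_upwards [hlim.eventually h, hζ1] with q hq hq'
  rw [hq, hq']

/-- The derivative of the initial gradient map has as its graph the image of the diagonal. -/
theorem IsInitialGradientMap.fderiv_eq (h : IsInitialGradientMap α z₀ t₀ φ₀)
    (htr : α.IsTransversal z₀ t₀) (u : Phase n) :
    (fderiv ℝ (α.map t₀ t₀) (z₀, z₀) (u, u)).1 =
      fderiv ℝ (fun w => φ₀ w t₀) (α.two z₀ z₀ t₀ t₀)
        (fderiv ℝ (α.map t₀ t₀) (z₀, z₀) (u, u)).2 := by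
  have hd : DifferentiableAt ℝ (fun z' => α.map t₀ t₀ (z', z')) z₀ :=
    (α.differentiableAt_slice t₀ t₀ (z₀, z₀)).comp z₀ (f := fun z' => (z', z')) (by fun_prop)
  have hφ : DifferentiableAt ℝ (fun w => φ₀ w t₀) (α.two z₀ z₀ t₀ t₀) :=
    (h.smoothNear htr).differentiableAt.comp _ (f := fun w => (w, t₀)) (by fun_prop)
  have h1 : (fun z => (α.map t₀ t₀ (z, z)).1) =ᶠ[𝓝 z₀]
      fun z => φ₀ (α.map t₀ t₀ (z, z)).2 t₀ :=
    ((Continuous.prodMk_left t₀).tendsto z₀).eventually h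
  have h2 := h1.fderiv_eq (𝕜 := ℝ)
  have h3 : fderiv ℝ (fun z => φ₀ (α.map t₀ t₀ (z, z)).2 t₀) z₀ = _ :=
    (hφ.hasFDerivAt.comp z₀ (f := fun z => (α.map t₀ t₀ (z, z)).2) hd.snd.hasFDerivAt).fderiv
  rw [h3, fderiv.fst hd, fderiv.snd hd] at h2
  have h4 := congrArg (fun L => L u) h2
  simp only [ContinuousLinearMap.comp_apply, fderiv_map_diag] at h4
  exact h4

/-- The implicit relation can be solved for the new state: the image of the vertical space meets the
image of the diagonal, a graph, only in zero. -/
theorem IsInitialGradientMap.eq_zero (h : IsInitialGradientMap α z₀ t₀ φ₀)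
    (htr : α.IsTransversal z₀ t₀) {v : Phase n}
    (hv : (fderiv ℝ (α.map t₀ t₀) (z₀, z₀) (v, 0)).1 =
      fderiv ℝ (fun w => φ₀ w t₀) (α.two z₀ z₀ t₀ t₀)
        (fderiv ℝ (α.map t₀ t₀) (z₀, z₀) (v, 0)).2) : v = 0 := by
  obtain ⟨u, hu⟩ := htr.exists_eq (fderiv ℝ (α.map t₀ t₀) (z₀, z₀) (v, 0)).2
  have h1 := h.fderiv_eq htr u
  rw [hu, ← hv] at h1
  have h2 := α.fderiv_injective t₀ t₀ (z₀, z₀) (Prod.ext h1 hu)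
  have h3 := congrArg Prod.snd h2
  have h4 := congrArg Prod.fst h2
  simp only at h3 h4
  rw [← h4, h3]

end Initial

/-! ### The one-step map of the scheme -/

section Scheme

variable {n : ℕ} {S : System n} {α : Transformation n} {φ₀ : Phase n → ℝ → Phase n}
  {z₀ : Phase n} {t₀ : ℝ} {m : ℕ}

/-- The point `((w, s), τ)` with `w = α₂(g((z,s),τ), z, s + τ, s)`, at which the truncated series is
evaluated in a step from `z` at time `s` to `g((z,s),τ)` at time `s + τ`. -/
def stepPoint (α : Transformation n) (g : (Phase n × ℝ) × ℝ → Phase n) (x : (Phase n × ℝ) × ℝ) :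
    (Phase n × ℝ) × ℝ :=
  ((α.two (g x) x.1.1 (x.1.2 + x.2) x.1.2, x.1.2), x.2)

/-- `g((z,s),τ)`, the state at time `s + τ` after one step from the state `z` at time `s`, is a smooth
solution near `(z₀, t₀)` of the implicit relation of the scheme with `g((z,s),0) = z`. -/
structure IsStepMap (S : System n) (α : Transformation n) (φ₀ : Phase n → ℝ → Phase n) (m : ℕ)
    (z₀ : Phase n) (t₀ : ℝ) (g : (Phase n × ℝ) × ℝ → Phase n) : Prop where
  smooth : SmoothNear g ((z₀, t₀), 0)
  initial : ∀ᶠ p in 𝓝 (z₀, t₀), g (p, 0) = p.1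
  relation : ∀ᶠ x in 𝓝 ((z₀, t₀), (0 : ℝ)),
    SchemeRelation S α φ₀ m (g x) x.1.1 (x.1.2 + x.2) x.1.2

theorem seriesDeriv_zero (m : ℕ) (p : Phase n × ℝ) :
    seriesDeriv S α φ₀ m (p, 0) = fderiv ℝ (fun w => φ₀ w p.2) p.1 := by
  simp [seriesDeriv, Finset.sum_range_succ' _ m, coeff_zero]

theorem exists_stepMap (hA : ContDiff ℝ ∞ (rhsFun S α)) (htr : α.IsTransversal z₀ t₀)
    (h : IsInitialGradientMap α z₀ t₀ φ₀) (m : ℕ) :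
    ∃ g, IsStepMap S α φ₀ m z₀ t₀ g ∧ ∃ V : Set (Phase n), IsOpen V ∧ z₀ ∈ V ∧
      ∀ᶠ x in 𝓝 ((z₀, t₀), (0 : ℝ)), g x ∈ V ∧
        ∀ z' ∈ V, SchemeRelation S α φ₀ m z' x.1.1 (x.1.2 + x.2) x.1.2 ↔ z' = g x := by
  have hφ := h.smoothNear htr
  have hc := fun k => smoothNear_coeff hA hφ k
  let q : Phase n × ((Phase n × ℝ) × ℝ) → Phase n × Phase n := fun y => (y.1, y.2.1.1)
  let M : Phase n × ((Phase n × ℝ) × ℝ) → Phase n × Phase n := fun y =>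
    α.map (y.2.1.2 + y.2.2) y.2.1.2 (q y)
  have hM : ∀ y, SmoothNear M y := fun y =>
    α.smoothNear_map (ContDiff.smoothNear (by fun_prop) _) (ContDiff.smoothNear (by fun_prop) _)
      (ContDiff.smoothNear (by fun_prop) _)
  let pt : Phase n × ((Phase n × ℝ) × ℝ) → (Phase n × ℝ) × ℝ := fun y =>
    (((M y).2, y.2.1.2), y.2.2)
  have hpt : ∀ y, SmoothNear pt y := fun y =>
    ((SmoothNear.comp (g := Prod.snd) (contDiff_snd.smoothNear _) (hM y)).prodMk
      (ContDiff.smoothNear (by fun_prop) _)).prodMk (ContDiff.smoothNear (by fun_prop) _)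
  let H : Phase n × ((Phase n × ℝ) × ℝ) → Phase n := fun y => (M y).1 - series S α φ₀ m (pt y)
  have hpt0 : pt (z₀, ((z₀, t₀), 0)) = ((α.two z₀ z₀ t₀ t₀, t₀), 0) := by
    simp only [pt, M, q, add_zero]; rfl
  have hser : SmoothNear (series S α φ₀ m) (pt (z₀, ((z₀, t₀), 0))) := by
    rw [hpt0]; exact smoothNear_series (fun i _ => hc i) 0
  have hH : SmoothNear H (z₀, ((z₀, t₀), 0)) :=
    (SmoothNear.comp (g := Prod.fst) (contDiff_fst.smoothNear _) (hM _)).sub (hser.comp (hpt _))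
  have hrel : ∀ y, H y = 0 ↔
      SchemeRelation S α φ₀ m y.1 y.2.1.1 (y.2.1.2 + y.2.2) y.2.1.2 := by
    intro y
    rw [SchemeRelation, truncated_eq_series, add_sub_cancel_left, sub_eq_zero]
    rfl
  have hdiag : ∀ z s, H (z, ((z, s), 0)) = α.one z z s s - φ₀ (α.two z z s s) s := by
    intro z s
    simp only [H, pt, series_zero, M, q, add_zero]
    rfl
  have hinit : ∀ᶠ p in 𝓝 (z₀, t₀), H (p.1, (p, 0)) = 0 := by
    filter_upwards [h] with p hp
    exact (hdiag p.1 p.2).trans (sub_eq_zero.2 hp)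
  obtain ⟨g, hg, hg0, V, hV, hz₀V, hmem⟩ := exists_implicit hH hinit.self_of_nhds (by
    intro v hv
    rw [← fderiv_partial_left hH.differentiableAt] at hv
    have hd : DifferentiableAt ℝ (fun z' => α.map t₀ t₀ (z', z₀)) z₀ :=
      (α.differentiableAt_slice t₀ t₀ (z₀, z₀)).comp z₀ (f := fun z' => (z', z₀)) (by fun_prop)
    have hφd : DifferentiableAt ℝ (fun w => φ₀ w t₀) (α.two z₀ z₀ t₀ t₀) :=
      hφ.differentiableAt.comp _ (f := fun w => (w, t₀)) (by fun_prop)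
    have h1 : (fun z' => H (z', ((z₀, t₀), 0))) = fun z' =>
        (α.map t₀ t₀ (z', z₀)).1 - φ₀ (α.map t₀ t₀ (z', z₀)).2 t₀ := by
      funext z'
      simp only [H, pt, series_zero, M, q, add_zero]
    have h2 := hφd.hasFDerivAt.comp z₀ (f := fun z' => (α.map t₀ t₀ (z', z₀)).2)
      hd.snd.hasFDerivAt
    have h3 : fderiv ℝ (fun z' => (α.map t₀ t₀ (z', z₀)).1 - φ₀ (α.map t₀ t₀ (z', z₀)).2 t₀) z₀ =
        _ := (hd.fst.hasFDerivAt.sub h2).fderiv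
    have h4 := fderiv_partial_left (f := α.map t₀ t₀) (a := z₀) (b := z₀)
      (α.differentiableAt_slice t₀ t₀ (z₀, z₀)) v
    rw [h1, h3, sub_apply, sub_eq_zero,
      ContinuousLinearMap.comp_apply, fderiv.fst hd, fderiv.snd hd] at hv
    simp only [ContinuousLinearMap.comp_apply, h4] at hv
    exact h.eq_zero htr hv)
  refine ⟨g, ⟨hg, ?_, ?_⟩, V, hV, hz₀V, ?_⟩
  · filter_upwards [hinit, (tendsto_prodMk_zero (z₀, t₀)).eventually hmem,
      (continuousAt_fst (p := (z₀, t₀))).eventually (hV.mem_nhds hz₀V)] with p h1 h2 h3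
    exact ((h2.2 _ h3).1 h1).symm
  · filter_upwards [hmem] with x hx
    exact (hrel (g x, x)).1 ((hx.2 _ hx.1).2 rfl)
  · filter_upwards [hmem] with x hx
    exact ⟨hx.1, fun z' hz' => (hrel (z', x)).symm.trans (hx.2 z' hz')⟩

namespace IsStepMap

variable {g : (Phase n × ℝ) × ℝ → Phase n}

theorem base (hg : IsStepMap S α φ₀ m z₀ t₀ g) : g ((z₀, t₀), 0) = z₀ := hg.initial.self_of_nhds

theorem stepPoint_base (hg : IsStepMap S α φ₀ m z₀ t₀ g) :
    stepPoint α g ((z₀, t₀), 0) = ((α.two z₀ z₀ t₀ t₀, t₀), 0) := by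
  simp only [stepPoint, hg.base, add_zero]

theorem smoothNear_pair {x : (Phase n × ℝ) × ℝ} (hg : SmoothNear g x) :
    SmoothNear (fun y => α.map (y.1.2 + y.2) y.1.2 (g y, y.1.1)) x :=
  α.smoothNear_map (hg.prodMk (ContDiff.smoothNear (by fun_prop) _))
    (ContDiff.smoothNear (by fun_prop) _) (ContDiff.smoothNear (by fun_prop) _)

theorem smoothNear_stepPoint {x : (Phase n × ℝ) × ℝ} (hg : SmoothNear g x) :
    SmoothNear (stepPoint α g) x :=
  ((SmoothNear.comp (g := Prod.snd) (contDiff_snd.smoothNear _) (smoothNear_pair hg)).prodMk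
      (ContDiff.smoothNear (by fun_prop) _)).prodMk (ContDiff.smoothNear (by fun_prop) _)

theorem tendsto_stepPoint (hg : IsStepMap S α φ₀ m z₀ t₀ g) :
    Tendsto (stepPoint α g) (𝓝 ((z₀, t₀), 0)) (𝓝 ((α.two z₀ z₀ t₀ t₀, t₀), 0)) := by
  have h := (smoothNear_stepPoint (α := α) hg.smooth).continuousAt
  rwa [ContinuousAt, hg.stepPoint_base] at h

/-- The derivative of the transformed pair `(α₁, α₂)(g, z, s + τ, s)` in a direction that leaves `s`
fixed, by the chain rule and through the generating relation `α₁ = series(α₂)`. -/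
theorem fderiv_pair (hg : IsStepMap S α φ₀ m z₀ t₀ g)
    (hc : ∀ k, SmoothNear (fun q : Phase n × ℝ => coeff S α φ₀ k q.1 q.2)
      (α.two z₀ z₀ t₀ t₀, t₀)) :
    ∀ᶠ x in 𝓝 ((z₀, t₀), (0 : ℝ)), ∀ (u : Phase n) (b : ℝ), ∃ q : Phase n,
      fderiv ℝ (stepPoint α g) x ((u, 0), b) = ((q, 0), b) ∧
      fderiv ℝ (α.map (x.1.2 + x.2) x.1.2) (g x, x.1.1) (fderiv ℝ g x ((u, 0), b), u) +
        b • deriv (fun t' => α.map t' x.1.2 (g x, x.1.1)) (x.1.2 + x.2) =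
      (seriesDeriv S α φ₀ m (stepPoint α g x) q +
        b • timeDeriv (series S α φ₀ m) (stepPoint α g x), q) := by
  have hc' : ∀ᶠ p in 𝓝 (α.two z₀ z₀ t₀ t₀, t₀), ∀ i ≤ m,
      SmoothNear (fun q : Phase n × ℝ => coeff S α φ₀ i q.1 q.2) p := by
    filter_upwards [eventually_all_finset (Finset.range (m + 1)) |>.2
      fun j _ => (hc j).eventually] with p hp i hi
    exact hp i (by simp; omega)
  have hc'' := hg.tendsto_stepPoint.eventually
    ((continuousAt_fst (p := ((α.two z₀ z₀ t₀ t₀, t₀), (0 : ℝ)))).eventually hc')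
  filter_upwards [hg.relation.eventually_nhds, hg.smooth.eventually, hc''] with x hrel hgx hcx u b
  have hpair := (smoothNear_pair (α := α) hgx).differentiableAt
  have hstep := (smoothNear_stepPoint (α := α) hgx).differentiableAt
  have hser : DifferentiableAt ℝ (series S α φ₀ m) (stepPoint α g x) :=
    (smoothNear_series hcx (stepPoint α g x).2).differentiableAt
  have hs : ∀ w : (Phase n × ℝ) × ℝ, fderiv ℝ (fun y : (Phase n × ℝ) × ℝ => y.1.2) x w = w.1.2 := by
    intro w
    have h : HasFDerivAt (fun y : (Phase n × ℝ) × ℝ => y.1.2)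
      ((ContinuousLinearMap.snd ℝ (Phase n) ℝ).comp (ContinuousLinearMap.fst ℝ (Phase n × ℝ) ℝ)) x :=
      ((ContinuousLinearMap.snd ℝ (Phase n) ℝ).comp
        (ContinuousLinearMap.fst ℝ (Phase n × ℝ) ℝ)).hasFDerivAt
    rw [h.fderiv]; rfl
  -- the two computations of the derivative of the pair
  have h1 := α.fderiv_map_comp (q := fun y : (Phase n × ℝ) × ℝ => (g y, y.1.1))
    (t := fun y => y.1.2 + y.2) (s := fun y => y.1.2) (x := x) (u := ((u, 0), b))
    (hgx.differentiableAt.prodMk (by fun_prop)) (by fun_prop) (by fun_prop) (by rw [hs])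
  have h2 : fderiv ℝ (fun y : (Phase n × ℝ) × ℝ => (g y, y.1.1)) x ((u, 0), b) =
      (fderiv ℝ g x ((u, 0), b), u) := by
    have h : HasFDerivAt (fun y : (Phase n × ℝ) × ℝ => y.1.1)
      ((ContinuousLinearMap.fst ℝ (Phase n) ℝ).comp (ContinuousLinearMap.fst ℝ (Phase n × ℝ) ℝ)) x :=
      ((ContinuousLinearMap.fst ℝ (Phase n) ℝ).comp
        (ContinuousLinearMap.fst ℝ (Phase n × ℝ) ℝ)).hasFDerivAt
    rw [(hgx.differentiableAt.hasFDerivAt.prodMk h).fderiv]; rfl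
  rw [h2, System.fderiv_clock] at h1
  simp only [zero_add] at h1
  set q : Phase n := (fderiv ℝ (fun y : (Phase n × ℝ) × ℝ =>
    α.map (y.1.2 + y.2) y.1.2 (g y, y.1.1)) x ((u, 0), b)).2 with hq
  have h3 : fderiv ℝ (stepPoint α g) x ((u, 0), b) = ((q, 0), b) := by
    have h := (hpair.hasFDerivAt.snd.prodMk (((ContinuousLinearMap.snd ℝ (Phase n) ℝ).comp
        (ContinuousLinearMap.fst ℝ (Phase n × ℝ) ℝ)).hasFDerivAt (x := x))).prodMk
      ((ContinuousLinearMap.snd ℝ (Phase n × ℝ) ℝ).hasFDerivAt (x := x))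
    have h' : fderiv ℝ (stepPoint α g) x = _ := HasFDerivAt.fderiv h
    rw [h']; rfl
  refine ⟨q, h3, ?_⟩
  rw [← h1]
  refine Prod.ext ?_ hq.symm
  have h4 : (fun y : (Phase n × ℝ) × ℝ => (α.map (y.1.2 + y.2) y.1.2 (g y, y.1.1)).1) =ᶠ[𝓝 x]
      fun y => series S α φ₀ m (stepPoint α g y) := by
    filter_upwards [hrel] with y hy
    rw [SchemeRelation, truncated_eq_series, add_sub_cancel_left] at hy
    exact hy
  have h5 := congrArg (fun L => L ((u, 0), b)) (h4.fderiv_eq (𝕜 := ℝ))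
  have h6 : fderiv ℝ (fun y => series S α φ₀ m (stepPoint α g y)) x = _ :=
    (hser.hasFDerivAt.comp x hstep.hasFDerivAt).fderiv
  rw [h6, fderiv.fst hpair] at h5
  simp only [ContinuousLinearMap.comp_apply, h3] at h5
  have h7 := fderiv_series hcx (stepPoint α g x).2 q b
  exact h5.trans h7

/-- Operators close to an injective one in finite dimension have locally bounded inverses. -/
theorem isBigO_of_clm_apply {F : Type*} [NormedAddCommGroup F] [NormedSpace ℝ F]
    [FiniteDimensional ℝ F] {X : Type*} [TopologicalSpace X] {Q : X → F →L[ℝ] F} {e : X → F}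
    {x₀ : X} {ρ : X → ℝ} (hQ : ContinuousAt Q x₀) (hinj : ∀ v, Q x₀ v = 0 → v = 0)
    (h : (fun x => Q x (e x)) =O[𝓝 x₀] ρ) : e =O[𝓝 x₀] ρ := by
  have : CompleteSpace F := FiniteDimensional.complete ℝ F
  let E : F ≃L[ℝ] F := (LinearEquiv.ofInjectiveEndo (Q x₀ : F →ₗ[ℝ] F)
    ((injective_iff_map_eq_zero _).2 hinj)).toContinuousLinearEquiv
  have hE : (E : F →L[ℝ] F) = Q x₀ := by ext x; rfl
  have hinv : ContinuousAt ContinuousLinearMap.inverse (Q x₀) := by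
    rw [← hE]; exact (contDiffAt_map_inverse (n := 1) E).continuousAt
  refine (isBigO_clm_apply (ContinuousAt.comp hinv hQ) h).congr' ?_ EventuallyEq.rfl
  have hn := hQ.eventually (by rw [← hE]; exact ContinuousLinearEquiv.nhds E)
  filter_upwards [hn] with x hx
  obtain ⟨E', hE'⟩ := hx
  simp only [Function.comp_apply, ← hE', ContinuousLinearMap.inverse_equiv]
  simp

/-- The one-step map solves the equations of motion up to a defect `O(τ^m)`. -/
theorem defect_isBigO (hg : IsStepMap S α φ₀ m z₀ t₀ g) (hA : ContDiff ℝ ∞ (rhsFun S α))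
    (htr : α.IsTransversal z₀ t₀) (h : IsInitialGradientMap α z₀ t₀ φ₀) :
    (fun x => fderiv ℝ g x (0, 1) - S.field (g x) (x.1.2 + x.2)) =O[𝓝 ((z₀, t₀), 0)]
      fun x => x.2 ^ m := by
  have hφ := h.smoothNear htr
  have hc := fun k => smoothNear_coeff hA hφ k
  let D : (Phase n × ℝ) × ℝ → (Phase n × Phase n →L[ℝ] Phase n × Phase n) := fun x =>
    fderiv ℝ (α.map (x.1.2 + x.2) x.1.2) (g x, x.1.1)
  have hD : ContinuousAt D ((z₀, t₀), 0) := (α.smoothNear_fderiv_map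
    (hg.smooth.prodMk (ContDiff.smoothNear (by fun_prop) _))
    (ContDiff.smoothNear (by fun_prop) _) (ContDiff.smoothNear (by fun_prop) _)).continuousAt
  let P : (Phase n × ℝ) × ℝ → (Phase n →L[ℝ] Phase n) := fun x =>
    seriesDeriv S α φ₀ m (stepPoint α g x)
  have hP : ContinuousAt P ((z₀, t₀), 0) := by
    refine ContinuousAt.comp (g := seriesDeriv S α φ₀ m) ?_
      (smoothNear_stepPoint hg.smooth).continuousAt
    rw [hg.stepPoint_base]
    exact (smoothNear_seriesDeriv (fun i _ => hc i) 0).continuousAt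
  -- `Q v = A_α v - P C_α v`
  let Q : (Phase n × ℝ) × ℝ → (Phase n →L[ℝ] Phase n) := fun x =>
    (ContinuousLinearMap.fst ℝ (Phase n) (Phase n)).comp
      ((D x).comp (ContinuousLinearMap.inl ℝ (Phase n) (Phase n))) -
    (P x).comp ((ContinuousLinearMap.snd ℝ (Phase n) (Phase n)).comp
      ((D x).comp (ContinuousLinearMap.inl ℝ (Phase n) (Phase n))))
  have hDi : ContinuousAt (fun x => (D x).comp (ContinuousLinearMap.inl ℝ (Phase n) (Phase n)))
      ((z₀, t₀), 0) := hD.clm_comp continuousAt_const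
  have hQ : ContinuousAt Q ((z₀, t₀), 0) :=
    (continuousAt_const.clm_comp hDi).sub (hP.clm_comp (continuousAt_const.clm_comp hDi))
  have hQv : ∀ x v, Q x v = (D x (v, 0)).1 - P x (D x (v, 0)).2 := fun x v => rfl
  refine isBigO_of_clm_apply hQ (fun v hv => ?_) ?_
  · rw [hQv, sub_eq_zero] at hv
    simp only [D, P, hg.stepPoint_base, seriesDeriv_zero, hg.base, add_zero] at hv
    exact h.eq_zero htr hv
  · have hres := (residual_isBigO hA m hφ).comp_tendsto hg.tendsto_stepPoint
    refine hres.congr' ?_ (Eventually.of_forall fun x => rfl)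
    filter_upwards [hg.fderiv_pair hc, hg.relation] with x hx hrel
    obtain ⟨q, -, hq⟩ := hx 0 1
    rw [SchemeRelation, truncated_eq_series, add_sub_cancel_left] at hrel
    have hsymm : (α.map (x.1.2 + x.2) x.1.2).symm
        (series S α φ₀ m (stepPoint α g x), (stepPoint α g x).1.1) = (g x, x.1.1) := by
      rw [Equiv.symm_apply_eq]
      exact Prod.ext hrel.symm rfl
    have hrhs : seriesRhs S α φ₀ m (stepPoint α g x) =
        rhsBar S α (g x) x.1.1 (P x) (x.1.2 + x.2) x.1.2 := by
      have h1 : seriesRhs S α φ₀ m (stepPoint α g x) = rhsBar S α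
        ((α.map (x.1.2 + x.2) x.1.2).symm
          (series S α φ₀ m (stepPoint α g x), (stepPoint α g x).1.1)).1
        ((α.map (x.1.2 + x.2) x.1.2).symm
          (series S α φ₀ m (stepPoint α g x), (stepPoint α g x).1.1)).2 (P x)
          (x.1.2 + x.2) x.1.2 := rfl
      rw [h1, hsymm]
    have hdmap : DifferentiableAt ℝ (fun t' => α.map t' x.1.2 (g x, x.1.1)) (x.1.2 + x.2) :=
      (α.smooth_map.differentiable (by simp) _).comp (x.1.2 + x.2)
        (f := fun t' => ((g x, x.1.1), t', x.1.2)) (by fun_prop)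
    have hone : deriv (fun t' => α.one (g x) x.1.1 t' x.1.2) (x.1.2 + x.2) =
        (deriv (fun t' => α.map t' x.1.2 (g x, x.1.1)) (x.1.2 + x.2)).1 :=
      ((ContinuousLinearMap.fst ℝ (Phase n) (Phase n)).hasFDerivAt.comp_hasDerivAt _
        hdmap.hasDerivAt).deriv
    have htwo : deriv (fun t' => α.two (g x) x.1.1 t' x.1.2) (x.1.2 + x.2) =
        (deriv (fun t' => α.map t' x.1.2 (g x, x.1.1)) (x.1.2 + x.2)).2 :=
      ((ContinuousLinearMap.snd ℝ (Phase n) (Phase n)).hasFDerivAt.comp_hasDerivAt _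
        hdmap.hasDerivAt).deriv
    have hX : (S.K (g x) (x.1.2 + x.2))⁻¹.mulVec (S.force (g x) (x.1.2 + x.2)) =
        S.field (g x) (x.1.2 + x.2) := rfl
    rw [one_smul, one_smul] at hq
    have hq1 := congrArg Prod.fst hq
    have hq2 := congrArg Prod.snd hq
    simp only [Prod.fst_add, Prod.snd_add] at hq1 hq2
    rw [Function.comp_apply, hrhs, rhsBar]
    simp only [hX, hone, htwo, Transformation.A_mulVec, Transformation.C_mulVec]
    rw [hQv]
    have hsub : ((fderiv ℝ g x (0, 1) - S.field (g x) (x.1.2 + x.2), 0) : Phase n × Phase n) =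
        (fderiv ℝ g x (0, 1), 0) - (S.field (g x) (x.1.2 + x.2), 0) := by simp
    rw [hsub, map_sub, Prod.fst_sub, Prod.snd_sub, map_sub]
    have hq3 := congrArg (P x) hq2
    rw [map_add] at hq3
    have hq1' : (D x (fderiv ℝ g x (0, 1), 0)).1 + _ = P x q + _ := hq1
    have hq3' : P x (D x (fderiv ℝ g x (0, 1), 0)).2 + _ = P x q := hq3
    rw [eq_sub_of_add_eq hq1', ← hq3']
    simp only [D]
    abel

end IsStepMap
end Scheme

/-! ### Symmetry of the coefficients -/

section Symmetry

variable {n : ℕ} {S : System n} {α : Transformation n} {φ₀ : Phase n → ℝ → Phase n}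
  {z₀ : Phase n} {t₀ : ℝ} {m : ℕ}

theorem System.form_linear_expand (S : System n) (z : Phase n) (t : ℝ)
    (L : Phase n →L[ℝ] Phase n) (u v : Phase n) :
    S.form z t (L u) (L v) = ∑ i, ∑ j, u i * v j *
      S.form z t (L (Pi.single i 1)) (L (Pi.single j 1)) := by
  have hu : ∀ u : Phase n, L u = ∑ i, u i • L (Pi.single i 1) := by
    intro u
    conv_lhs => rw [← Finset.univ_sum_single u, map_sum]
    refine Finset.sum_congr rfl fun i _ => ?_
    rw [← map_smul, ← Pi.single_smul, smul_eq_mul, mul_one]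
  have hright : ∀ w, S.form z t w (L v) = ∑ j, v j * S.form z t w (L (Pi.single j 1)) := by
    intro w
    rw [S.form_swap, hu v, S.form_sum_left, ← Finset.sum_neg_distrib]
    refine Finset.sum_congr rfl fun j _ => ?_
    rw [S.form_smul_left, S.form_swap _ _ w]; ring
  rw [hu u, S.form_sum_left]
  refine Finset.sum_congr rfl fun i _ => ?_
  rw [S.form_smul_left, hright, Finset.mul_sum]
  refine Finset.sum_congr rfl fun j _ => ?_
  ring

namespace IsStepMap

variable {g : (Phase n × ℝ) × ℝ → Phase n}

/-- The antisymmetric part of the derivative of the truncated series measures by how much the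
one-step map fails to be symplectic. -/
theorem antisymm_seriesDeriv_eq (hg : IsStepMap S α φ₀ m z₀ t₀ g) (hα : α.IsAdapted S)
    (hc : ∀ k, SmoothNear (fun q : Phase n × ℝ => coeff S α φ₀ k q.1 q.2)
      (α.two z₀ z₀ t₀ t₀, t₀)) :
    ∀ᶠ x in 𝓝 ((z₀, t₀), (0 : ℝ)), ∀ u v : Phase n,
      seriesDeriv S α φ₀ m (stepPoint α g x) (fderiv ℝ (stepPoint α g) x ((u, 0), 0)).1.1 ⬝ᵥ
          (fderiv ℝ (stepPoint α g) x ((v, 0), 0)).1.1 -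
        (fderiv ℝ (stepPoint α g) x ((u, 0), 0)).1.1 ⬝ᵥ
          seriesDeriv S α φ₀ m (stepPoint α g x) (fderiv ℝ (stepPoint α g) x ((v, 0), 0)).1.1 =
      S.form (g x) (x.1.2 + x.2) (fderiv ℝ g x ((u, 0), 0)) (fderiv ℝ g x ((v, 0), 0)) -
        S.form x.1.1 x.1.2 u v := by
  filter_upwards [hg.fderiv_pair hc] with x hx u v
  obtain ⟨q, hq, hq'⟩ := hx u 0
  obtain ⟨r, hr, hr'⟩ := hx v 0
  simp only [zero_smul, add_zero] at hq' hr'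
  have h := hα.form_eq (g x) x.1.1 (x.1.2 + x.2) x.1.2 (fderiv ℝ g x ((u, 0), 0), u)
    (fderiv ℝ g x ((v, 0), 0), v)
  rw [hq', hr'] at h
  rw [hq, hr]
  exact h

/-- The derivative in `w` of the truncated series is symmetric: its antisymmetric part is a
polynomial of degree at most `m` in `τ`, and is of order `O(τ^(m+1))` because the one-step map is
symplectic up to that order. -/
theorem seriesDeriv_symm (hg : IsStepMap S α φ₀ m z₀ t₀ g) (hS : S.Regular) (hα : α.IsAdapted S)
    (hA : ContDiff ℝ ∞ (rhsFun S α)) (htr : α.IsTransversal z₀ t₀)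
    (h : IsInitialGradientMap α z₀ t₀ φ₀) :
    ∀ᶠ p in 𝓝 (α.two z₀ z₀ t₀ t₀, t₀), ∀ (τ : ℝ) (a b : Phase n),
      seriesDeriv S α φ₀ m (p, τ) a ⬝ᵥ b = a ⬝ᵥ seriesDeriv S α φ₀ m (p, τ) b := by
  have hc := fun k => smoothNear_coeff hA (h.smoothNear htr) k
  -- `Z((w, s), τ)` is the initial state of the step through the point `w`
  let X : Phase n × ((Phase n × ℝ) × ℝ) → (Phase n × ℝ) × ℝ := fun q => ((q.1, q.2.1.2), q.2.2)
  let H : Phase n × ((Phase n × ℝ) × ℝ) → Phase n := fun q => (stepPoint α g (X q)).1.1 - q.2.1.1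
  have hX : ∀ q, SmoothNear X q := fun q => ContDiff.smoothNear (by fun_prop) _
  have hfst : ∀ x : (Phase n × ℝ) × ℝ, SmoothNear (fun x : (Phase n × ℝ) × ℝ => x.1.1) x :=
    fun x => ContDiff.smoothNear (by fun_prop) _
  have hst : SmoothNear (stepPoint α g) ((z₀, t₀), 0) := smoothNear_stepPoint hg.smooth
  have hH : SmoothNear H (z₀, ((α.two z₀ z₀ t₀ t₀, t₀), 0)) :=
    (SmoothNear.comp (g := fun x : (Phase n × ℝ) × ℝ => x.1.1) (hfst _)
      (SmoothNear.comp (g := stepPoint α g) (f := X)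
        (x := (z₀, ((α.two z₀ z₀ t₀ t₀, t₀), 0))) hst (hX _))).sub (ContDiff.smoothNear (by fun_prop) _)
  obtain ⟨Z, hZ, hZ0, V, -, -, hmem⟩ := exists_implicit hH
    (by simp only [H, X, hg.stepPoint_base, sub_self]) (by
      intro v hv
      rw [← fderiv_partial_left hH.differentiableAt] at hv
      have hd : DifferentiableAt ℝ (fun z' => α.map t₀ t₀ (z', z')) z₀ :=
        (α.differentiableAt_slice t₀ t₀ (z₀, z₀)).comp z₀ (f := fun z' => (z', z')) (by fun_prop)
      have h1 : (fun z => H (z, ((α.two z₀ z₀ t₀ t₀, t₀), 0))) =ᶠ[𝓝 z₀]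
          fun z => (α.map t₀ t₀ (z, z)).2 - α.two z₀ z₀ t₀ t₀ := by
        filter_upwards [((Continuous.prodMk_left t₀).tendsto z₀).eventually hg.initial] with z hz
        simp only [H, X, stepPoint, hz, add_zero]
        rfl
      refine htr.eq_zero ?_
      rw [← fderiv_map_diag]
      rw [h1.fderiv_eq, fderiv_sub_const, fderiv.snd hd] at hv
      exact hv)
  let Y : (Phase n × ℝ) × ℝ → (Phase n × ℝ) × ℝ := fun y => X (Z y, y)
  have hY : ∀ y, SmoothNear Z y → SmoothNear Y y := fun y hy =>
    SmoothNear.comp (g := X) (f := fun y => (Z y, y)) (hX _) (hy.prodMk (contDiff_id.smoothNear _))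
  have hY0 : Y ((α.two z₀ z₀ t₀ t₀, t₀), 0) = ((z₀, t₀), 0) := by simp only [Y, X, hZ0]
  have hYlim : Tendsto Y (𝓝 ((α.two z₀ z₀ t₀ t₀, t₀), 0)) (𝓝 ((z₀, t₀), 0)) := by
    have h1 := (hY _ hZ).continuousAt
    rwa [ContinuousAt, hY0] at h1
  have hstepY : ∀ᶠ y in 𝓝 ((α.two z₀ z₀ t₀ t₀, t₀), (0 : ℝ)), stepPoint α g (Y y) = y := by
    filter_upwards [hmem] with y hy
    have h1 : H (Z y, y) = 0 := (hy.2 _ hy.1).2 rfl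
    exact Prod.ext (Prod.ext (sub_eq_zero.1 h1) rfl) rfl
  have hYder : ∀ y, SmoothNear Z y → ∀ a : Phase n,
      fderiv ℝ Y y ((a, 0), 0) = ((fderiv ℝ Z y ((a, 0), 0), 0), 0) := by
    intro y hy a
    have h1 := (hy.differentiableAt.hasFDerivAt.prodMk (((ContinuousLinearMap.snd ℝ (Phase n) ℝ).comp
        (ContinuousLinearMap.fst ℝ (Phase n × ℝ) ℝ)).hasFDerivAt (x := y))).prodMk
      ((ContinuousLinearMap.snd ℝ (Phase n × ℝ) ℝ).hasFDerivAt (x := y))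
    have h2 : fderiv ℝ Y y = _ := HasFDerivAt.fderiv h1
    rw [h2]; rfl
  let Δ : (Phase n × ℝ) × ℝ → Phase n → Phase n → ℝ := fun x u v =>
    S.form (g x) (x.1.2 + x.2) (fderiv ℝ g x ((u, 0), 0)) (fderiv ℝ g x ((v, 0), 0)) -
      S.form x.1.1 x.1.2 u v
  have hΔexp : ∀ x u v, Δ x u v = ∑ i, ∑ j, u i * v j * Δ x (Pi.single i 1) (Pi.single j 1) := by
    intro x u v
    have h1 := S.form_linear_expand (g x) (x.1.2 + x.2) ((fderiv ℝ g x).comp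
      ((ContinuousLinearMap.inl ℝ (Phase n × ℝ) ℝ).comp (ContinuousLinearMap.inl ℝ (Phase n) ℝ))) u v
    have h2 := S.form_linear_expand x.1.1 x.1.2 (ContinuousLinearMap.id ℝ (Phase n)) u v
    simp only [ContinuousLinearMap.comp_apply, ContinuousLinearMap.inl_apply,
      ContinuousLinearMap.id_apply] at h1 h2
    simp only [Δ]
    rw [h1, h2]
    simp only [mul_sub, Finset.sum_sub_distrib]
  have hΔO : ∀ i j : Fin (2 * n), ∀ᶠ p in 𝓝 (α.two z₀ z₀ t₀ t₀, t₀),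
      (fun τ => Δ (Y (p, τ)) (Pi.single i 1) (Pi.single j 1)) =O[𝓝 0]
        fun τ => τ ^ (m + 1) := by
    intro i j
    have h1 := System.isBigO_form_pullback_sub hS hg.smooth hg.initial (hg.defect_isBigO hA htr h)
      (Pi.single i 1) (Pi.single j 1)
    exact isBigO_slice (r := fun y => Δ (Y y) (Pi.single i 1) (Pi.single j 1))
      (h1.comp_tendsto hYlim)
  have hkey : ∀ᶠ y in 𝓝 ((α.two z₀ z₀ t₀ t₀, t₀), (0 : ℝ)), ∀ a b : Phase n,
      seriesDeriv S α φ₀ m y a ⬝ᵥ b - a ⬝ᵥ seriesDeriv S α φ₀ m y b =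
        Δ (Y y) (fderiv ℝ Z y ((a, 0), 0)) (fderiv ℝ Z y ((b, 0), 0)) := by
    filter_upwards [hYlim.eventually (hg.antisymm_seriesDeriv_eq hα hc), hstepY.eventually_nhds,
      hZ.eventually, hYlim.eventually hst.eventually] with y h1 h2 h3 h4 a b
    have h5 : ∀ a : Phase n, (fderiv ℝ (stepPoint α g) (Y y)
        ((fderiv ℝ Z y ((a, 0), 0), 0), 0)) = ((a, 0), 0) := by
      intro a
      have h6 : (fun y => stepPoint α g (Y y)) =ᶠ[𝓝 y] fun y => y := h2
      have h7 : fderiv ℝ (fun y => stepPoint α g (Y y)) y = _ :=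
        (h4.differentiableAt.hasFDerivAt.comp y (hY y h3).differentiableAt.hasFDerivAt).fderiv
      have h8 := congrArg (fun L => L ((a, 0), 0)) (h7.symm.trans (h6.fderiv_eq (𝕜 := ℝ)))
      simp only [ContinuousLinearMap.comp_apply, hYder y h3, fderiv_fun_id,
        ContinuousLinearMap.id_apply] at h8
      exact h8
    have h9 := h1 (fderiv ℝ Z y ((a, 0), 0)) (fderiv ℝ Z y ((b, 0), 0))
    rw [h5, h5, h2.self_of_nhds] at h9
    exact h9
  filter_upwards [eventually_all.2 fun i => eventually_all.2 (hΔO i), hZ.slice,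
    (tendsto_prodMk_zero _).eventually hZ.eventually,
    (tendsto_prodMk_zero _).eventually hkey.eventually_nhds] with p hO hZp hZp' hkeyp τ a b
  have hlift : Tendsto (fun τ : ℝ => (p, τ)) (𝓝 0) (𝓝 (p, 0)) :=
    (Continuous.prodMk_right p).tendsto 0
  have hbdd : ∀ (c : Phase n) i, (fun τ => fderiv ℝ Z (p, τ) ((c, 0), 0) i) =O[𝓝 0]
      fun _ => (1 : ℝ) := by
    intro c i
    have h1 : ContinuousAt (fun y => fderiv ℝ Z y ((c, 0), 0) i) (p, 0) :=
      ((hZp'.fderiv.clm_apply (contDiff_const.smoothNear _)).apply i).continuousAt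
    exact (h1.tendsto.comp hlift).isBigO_one ℝ
  have hbig : (fun τ => seriesDeriv S α φ₀ m (p, τ) a ⬝ᵥ b - a ⬝ᵥ seriesDeriv S α φ₀ m (p, τ) b)
      =O[𝓝 0] fun τ => τ ^ (m + 1) := by
    have h1 : (fun τ => ∑ i, ∑ j, fderiv ℝ Z (p, τ) ((a, 0), 0) i *
        fderiv ℝ Z (p, τ) ((b, 0), 0) j * Δ (Y (p, τ)) (Pi.single i 1) (Pi.single j 1)) =O[𝓝 0]
          fun τ => τ ^ (m + 1) := by
      refine Asymptotics.IsBigO.fun_sum fun i _ => Asymptotics.IsBigO.fun_sum fun j _ => ?_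
      simpa using ((hbdd a i).mul (hbdd b j)).mul (hO i j)
    refine h1.congr' ?_ EventuallyEq.rfl
    filter_upwards [hlift.eventually hkeyp] with τ hτ
    rw [hτ, hΔexp]
  have hpoly : ∀ τ, seriesDeriv S α φ₀ m (p, τ) a ⬝ᵥ b - a ⬝ᵥ seriesDeriv S α φ₀ m (p, τ) b =
      ∑ i ∈ Finset.range (m + 1), τ ^ i •
        (fderiv ℝ (fun w' => coeff S α φ₀ i w' p.2) p.1 a ⬝ᵥ b -
          a ⬝ᵥ fderiv ℝ (fun w' => coeff S α φ₀ i w' p.2) p.1 b) := by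
    intro τ
    simp only [seriesDeriv, sum_apply, smul_apply, sum_dotProduct,
      dotProduct_sum, smul_dotProduct, dotProduct_smul, ← Finset.sum_sub_distrib, smul_sub]
  simp only [hpoly] at hbig
  have hzero := eq_zero_of_sum_pow_smul_isBigO hbig
  rw [← sub_eq_zero, hpoly]
  refine Finset.sum_eq_zero fun i hi => ?_
  rw [hzero i (by simp at hi; omega), smul_zero]

end IsStepMap

/-- A map of the phase space with symmetric derivative is a gradient near the point. -/
theorem exists_grad_eq {f : Phase n → Phase n} {s : Set (Phase n)} (hs : Convex ℝ s)
    (hso : IsOpen s) (hf : DifferentiableOn ℝ f s)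
    (hsymm : ∀ w ∈ s, ∀ a b, fderiv ℝ f w a ⬝ᵥ b = a ⬝ᵥ fderiv ℝ f w b) :
    ∃ ψ : Phase n → ℝ, ∀ w ∈ s, DifferentiableAt ℝ ψ w ∧ grad ψ w = f w := by
  let T : Phase n →L[ℝ] (Phase n →L[ℝ] ℝ) :=
    ∑ i, ContinuousLinearMap.smulRight (ContinuousLinearMap.proj i : Phase n →L[ℝ] ℝ)
      (ContinuousLinearMap.proj i : Phase n →L[ℝ] ℝ)
  have hT : ∀ u v, T u v = u ⬝ᵥ v := by
    intro u v
    simp [T, sum_apply, dotProduct]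
  have hder : ∀ w ∈ s, HasFDerivAt (fun w => T (f w)) (T.comp (fderiv ℝ f w)) w := fun w hw =>
    T.hasFDerivAt.comp w (hf.differentiableAt (hso.mem_nhds hw)).hasFDerivAt
  obtain ⟨ψ, hψ⟩ := hs.exists_forall_hasFDerivAt_of_fderiv_symmetric hso
    (fun w hw => (hder w hw).differentiableAt.differentiableWithinAt) (by
      intro w hw a b
      rw [(hder w hw).fderiv, ContinuousLinearMap.comp_apply, ContinuousLinearMap.comp_apply, hT,
        hT, hsymm w hw, dotProduct_comm])
  refine ⟨ψ, fun w hw => ⟨(hψ w hw).differentiableAt, ?_⟩⟩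
  funext i
  rw [grad, (hψ w hw).fderiv, hT]
  simp

end Symmetry

theorem System.isSolutionOn_iff {n : ℕ} {S : System n} (hS : S.Regular) {y : ℝ → Phase n}
    {a b : ℝ} : S.IsSolutionOn y a b ↔
      ∀ σ ∈ Set.Icc a b, HasDerivWithinAt y (S.field (y σ) σ) (Set.Icc a b) σ := by
  refine ⟨fun h σ hσ => ?_, fun h σ hσ => ⟨_, h σ hσ, System.K_mulVec_field hS _ _⟩⟩
  obtain ⟨v, hv, hv'⟩ := h σ hσ
  rwa [← System.eq_field hS hv']

/-- The matrix form of symplecticity from the identity of bilinear forms. -/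
theorem System.jacobian_transpose_mul_K_mul {n : ℕ} (S : System n) {g : Phase n → Phase n}
    {z : Phase n} {t s : ℝ}
    (h : ∀ u v, S.form (g z) t (fderiv ℝ g z u) (fderiv ℝ g z v) = S.form z s u v) :
    (jacobian g z).transpose * S.K (g z) t * jacobian g z = S.K z s := by
  have hentry : ∀ (M : Matrix (Fin (2 * n)) (Fin (2 * n)) ℝ) i j,
      M i j = Pi.single i 1 ⬝ᵥ M.mulVec (Pi.single j 1) := fun M i j => by simp
  ext i j
  refine (hentry _ i j).trans (Eq.trans ?_ (hentry _ i j).symm)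
  rw [S.dotProduct_K_mulVec z, ← h, ← S.dotProduct_K_mulVec,
    ← Matrix.mulVec_mulVec, ← Matrix.mulVec_mulVec, Matrix.mulVec_transpose, dotProduct_comm,
    ← Matrix.dotProduct_mulVec, jacobian_mulVec, jacobian_mulVec, dotProduct_comm]

/-! ### The gradient property and the accuracy of the scheme -/

section Gradient

variable {n : ℕ} {S : System n} {α : Transformation n} {φ₀ : Phase n → ℝ → Phase n}
  {z₀ : Phase n} {t₀ : ℝ}

/-- The truncated series is a gradient. -/
theorem exists_grad_eq_truncated (hS : S.Regular) (hα : α.IsAdapted S)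
    (hA : ContDiff ℝ ∞ (rhsFun S α)) (htr : α.IsTransversal z₀ t₀)
    (h : IsInitialGradientMap α z₀ t₀ φ₀) (m : ℕ) :
    ∃ ψ : Phase n → ℝ → ℝ → ℝ,
      ∀ᶠ p : Phase n × ℝ × ℝ in 𝓝 (α.two z₀ z₀ t₀ t₀, t₀, t₀),
        DifferentiableAt ℝ (fun w => ψ w p.2.1 p.2.2) p.1 ∧
        grad (fun w => ψ w p.2.1 p.2.2) p.1 = truncated S α φ₀ m p.1 p.2.1 p.2.2 := by
  obtain ⟨g, hg, -⟩ := exists_stepMap hA htr h m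
  have hc := fun k => smoothNear_coeff hA (h.smoothNear htr) k
  have hc' : ∀ᶠ p in 𝓝 (α.two z₀ z₀ t₀ t₀, t₀), ∀ i ≤ m,
      SmoothNear (fun q : Phase n × ℝ => coeff S α φ₀ i q.1 q.2) p := by
    filter_upwards [eventually_all_finset (Finset.range (m + 1)) |>.2
      fun j _ => (hc j).eventually] with p hp i hi
    exact hp i (by simp; omega)
  obtain ⟨ε, hε, hball⟩ := Metric.eventually_nhds_iff_ball.1
    (hc'.and (hg.seriesDeriv_symm hS hα hA htr h))
  have hex : ∀ t s, ∃ ψ : Phase n → ℝ, s ∈ Metric.ball t₀ ε →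
      ∀ w ∈ Metric.ball (α.two z₀ z₀ t₀ t₀) ε, DifferentiableAt ℝ ψ w ∧
        grad ψ w = truncated S α φ₀ m w t s := by
    intro t s
    by_cases hs : s ∈ Metric.ball t₀ ε
    · have hmem : ∀ w ∈ Metric.ball (α.two z₀ z₀ t₀ t₀) ε,
          (w, s) ∈ Metric.ball (α.two z₀ z₀ t₀ t₀, t₀) ε := fun w hw => by
        rw [← ball_prod_same]; exact ⟨hw, hs⟩
      have hd : ∀ w ∈ Metric.ball (α.two z₀ z₀ t₀ t₀) ε,
          HasFDerivAt (fun w => truncated S α φ₀ m w t s)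
            (seriesDeriv S α φ₀ m ((w, s), t - s)) w := fun w hw =>
        fderiv_series_slice (hball _ (hmem w hw)).1 (t - s)
      obtain ⟨ψ, hψ⟩ := exists_grad_eq (convex_ball (α.two z₀ z₀ t₀ t₀) ε) Metric.isOpen_ball
        (fun w hw => (hd w hw).differentiableAt.differentiableWithinAt) (fun w hw a b => by
          rw [(hd w hw).fderiv]; exact (hball _ (hmem w hw)).2 (t - s) a b)
      exact ⟨ψ, fun _ => hψ⟩
    · exact ⟨0, fun hs' => absurd hs' hs⟩
  choose ψ hψ using hex
  refine ⟨fun w t s => ψ t s w, ?_⟩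
  have h1 : ∀ᶠ p : Phase n × ℝ × ℝ in 𝓝 (α.two z₀ z₀ t₀ t₀, t₀, t₀),
      p.1 ∈ Metric.ball (α.two z₀ z₀ t₀ t₀) ε :=
    continuousAt_fst.eventually (Metric.ball_mem_nhds _ hε)
  have h2 : ∀ᶠ p : Phase n × ℝ × ℝ in 𝓝 (α.two z₀ z₀ t₀ t₀, t₀, t₀),
      p.2.2 ∈ Metric.ball t₀ ε :=
    (continuous_snd.comp continuous_snd).continuousAt.eventually (Metric.ball_mem_nhds _ hε)
  filter_upwards [h1, h2] with p hp1 hp2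
  exact hψ p.2.1 p.2.2 hp2 p.1 hp1

end Gradient

end Birkhoff

end

theorem theorem4p3 (n : ℕ) (S : Birkhoff.System n) (hS : S.Regular)
    (α : Birkhoff.Transformation n) (hα : α.IsAdapted S)
    (h𝒜 : AnalyticOnNhd ℝ
      (fun p : Birkhoff.Phase n × Birkhoff.Phase n ×
          (Birkhoff.Phase n →L[ℝ] Birkhoff.Phase n) × ℝ × ℝ =>
        Birkhoff.rhs S α p.1 p.2.1 p.2.2.1 p.2.2.2.1 p.2.2.2.2) Set.univ)
    (z₀ : Birkhoff.Phase n) (t₀ : ℝ) (htr : α.IsTransversal z₀ t₀) :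
    (∃ φ₀, Birkhoff.IsInitialGradientMap α z₀ t₀ φ₀) ∧
    ∀ φ₀, Birkhoff.IsInitialGradientMap α z₀ t₀ φ₀ → ∀ m : ℕ, 1 ≤ m →
      (∃ ψ : Birkhoff.Phase n → ℝ → ℝ → ℝ,
        ∀ᶠ p : Birkhoff.Phase n × ℝ × ℝ in 𝓝 (α.two z₀ z₀ t₀ t₀, t₀, t₀),
          DifferentiableAt ℝ (fun w => ψ w p.2.1 p.2.2) p.1 ∧
          Birkhoff.grad (fun w => ψ w p.2.1 p.2.2) p.1 =
            Birkhoff.truncated S α φ₀ m p.1 p.2.1 p.2.2) ∧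
      ∃ U V : Set (Birkhoff.Phase n), IsOpen U ∧ z₀ ∈ U ∧ IsOpen V ∧ z₀ ∈ V ∧
      ∃ δ > (0 : ℝ), ∃ τ₀ > (0 : ℝ), ∃ C : ℝ,
      ∃ g : Birkhoff.Phase n → ℝ → ℝ → Birkhoff.Phase n,
        ∀ t : ℝ, |t - t₀| < δ → ∀ τ : ℝ, 0 < τ → τ < τ₀ →
          -- the implicit relation defines the one-step map on `U`
          (∀ z ∈ U, g z (t + τ) t ∈ V ∧
            ∀ z' ∈ V, Birkhoff.SchemeRelation S α φ₀ m z' z (t + τ) t ↔ z' = g z (t + τ) t) ∧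
          -- the one-step map is symplectic
          S.IsSymplecticOn (fun z => g z (t + τ) t) (t + τ) t U ∧
          -- it is accurate of order `m`
          (∀ z ∈ U,
            (∃ y : ℝ → Birkhoff.Phase n, y t = z ∧ S.IsSolutionOn y t (t + τ)) ∧
            ∀ y : ℝ → Birkhoff.Phase n, y t = z → S.IsSolutionOn y t (t + τ) →
              ‖g z (t + τ) t - y (t + τ)‖ ≤ C * τ ^ (m + 1)) := by
  have hA : ContDiff ℝ ∞ (Birkhoff.rhsFun S α) := by
    rw [← contDiffOn_univ]
    exact (h𝒜.contDiffOn uniqueDiffOn_univ).of_le le_top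
  refine ⟨Birkhoff.exists_isInitialGradientMap htr, fun φ₀ h m _ =>
    ⟨Birkhoff.exists_grad_eq_truncated hS hα hA htr h m, ?_⟩⟩
  obtain ⟨g, hg, V, hV, hz₀V, hmem⟩ := Birkhoff.exists_stepMap hA htr h m
  obtain ⟨C, hC0, hC⟩ := (hg.defect_isBigO hA htr h).exists_pos
  obtain ⟨τ₁, hτ₁, L, hL, hode⟩ :=
    Birkhoff.exists_solution_and_defect_bound (Birkhoff.System.contDiff_field hS) z₀ t₀
  have hsymp : ∀ᶠ x in 𝓝 ((z₀, t₀), (0 : ℝ)), ∀ u v : Birkhoff.Phase n,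
      S.form (g x) (x.1.2 + x.2) (fderiv ℝ g x ((u, 0), 0)) (fderiv ℝ g x ((v, 0), 0)) =
        S.form x.1.1 x.1.2 u v := by
    filter_upwards [hg.antisymm_seriesDeriv_eq hα
        (fun k => Birkhoff.smoothNear_coeff hA (h.smoothNear htr) k),
      hg.tendsto_stepPoint.eventually ((continuousAt_fst (p :=
        ((α.two z₀ z₀ t₀ t₀, t₀), (0 : ℝ)))).eventually (hg.seriesDeriv_symm hS hα hA htr h))]
      with x hx hx' u v
    rw [← sub_eq_zero, ← hx u v, sub_eq_zero]
    exact hx' (Birkhoff.stepPoint α g x).2 _ _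
  have hnear : ∀ᶠ x in 𝓝 ((z₀, t₀), (0 : ℝ)), g x ∈ Metric.closedBall z₀ 1 :=
    hg.smooth.continuousAt.eventually (by
      rw [hg.base]; exact Metric.closedBall_mem_nhds _ one_pos)
  obtain ⟨ε, hε, hball⟩ := Metric.eventually_nhds_iff_ball.1
    (hmem.and (hsymp.and (hnear.and (hg.smooth.eventually.and hC.bound))))
  obtain ⟨ε', hε', hball'⟩ := Metric.eventually_nhds_iff_ball.1 hg.initial
  have hmemball : ∀ z ∈ Metric.ball z₀ ε, ∀ t, |t - t₀| < ε → ∀ τ, |τ| < ε →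
      (((z, t), τ) : (Birkhoff.Phase n × ℝ) × ℝ) ∈ Metric.ball ((z₀, t₀), (0 : ℝ)) ε := by
    intro z hz t ht τ hτ
    rw [← ball_prod_same, ← ball_prod_same]
    exact ⟨⟨hz, by rwa [Metric.mem_ball, Real.dist_eq]⟩,
      by rwa [Metric.mem_ball, Real.dist_eq, sub_zero]⟩
  set ρ := min (min ε ε') (1 / 2) with hρ
  have hρ0 : 0 < ρ := by positivity
  have hρε : ρ ≤ ε := (min_le_left _ _).trans (min_le_left _ _)
  have hρε' : ρ ≤ ε' := (min_le_left _ _).trans (min_le_right _ _)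
  refine ⟨Metric.ball z₀ ρ, V, Metric.isOpen_ball, Metric.mem_ball_self hρ0, hV, hz₀V,
    min ρ τ₁, by positivity, min ρ τ₁, by positivity, L * C,
    fun z t' t => g ((z, t), t' - t), ?_⟩
  intro t ht τ hτ0 hτ
  have htρ : |t - t₀| < ρ := ht.trans_le (min_le_left _ _)
  have hτρ : τ < ρ := hτ.trans_le (min_le_left _ _)
  have hx : ∀ z ∈ Metric.ball z₀ ρ, ∀ σ, 0 ≤ σ → σ ≤ τ →
      (((z, t), σ) : (Birkhoff.Phase n × ℝ) × ℝ) ∈ Metric.ball ((z₀, t₀), (0 : ℝ)) ε :=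
    fun z hz σ hσ0 hσ => hmemball z (Metric.ball_subset_ball hρε hz) t (htρ.trans_le hρε) σ
      (by rw [abs_of_nonneg hσ0]; linarith)
  simp only [add_sub_cancel_left]
  refine ⟨fun z hz => (hball _ (hx z hz τ hτ0.le le_rfl)).1, fun z hz => ?_, fun z hz => ?_⟩
  · obtain ⟨-, hs, -, hsm, -⟩ := hball _ (hx z hz τ hτ0.le le_rfl)
    have hd : DifferentiableAt ℝ (fun q => g (q, τ)) (z, t) :=
      hsm.differentiableAt.comp (z, t) (f := fun q => (q, τ)) (by fun_prop)
    have hder : ∀ u, fderiv ℝ (fun z => g ((z, t), τ)) z u =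
        fderiv ℝ g ((z, t), τ) ((u, 0), 0) := fun u => by
      rw [← Birkhoff.fderiv_partial_left hsm.differentiableAt, ← Birkhoff.fderiv_partial_left hd]
    refine ⟨hd.comp z (f := fun z => (z, t)) (by fun_prop),
      S.jacobian_transpose_mul_K_mul fun u v => ?_⟩
    rw [hder, hder]
    exact hs u v
  · obtain ⟨hex, hbound⟩ := hode t (ht.trans_le (min_le_right _ _)) z
      (Metric.ball_subset_ball (min_le_right _ _) hz) τ hτ0 (hτ.trans_le (min_le_right _ _))
    refine ⟨?_, fun y hy0 hy => ?_⟩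
    · obtain ⟨y, hy0, hy⟩ := hex
      exact ⟨y, hy0, (Birkhoff.System.isSolutionOn_iff hS).2 hy⟩
    · have hσ : ∀ σ ∈ Set.Icc t (t + τ), 0 ≤ σ - t ∧ σ - t ≤ τ := fun σ hσ =>
        ⟨by linarith [hσ.1], by linarith [hσ.2]⟩
      have hfin := hbound y hy0 ((Birkhoff.System.isSolutionOn_iff hS).1 hy)
        (fun σ => g ((z, t), σ - t)) (fun σ => fderiv ℝ g ((z, t), σ - t) (0, 1)) (C * τ ^ m)
        (by
          have := hball' (z, t) (by
            rw [← ball_prod_same]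
            exact ⟨Metric.ball_subset_ball hρε' hz, by
              rw [Metric.mem_ball, Real.dist_eq]; exact htρ.trans_le hρε'⟩)
          simpa only [sub_self] using this)
        (fun σ h1 => by
          obtain ⟨-, -, -, hsm, -⟩ := hball _ (hx z hz (σ - t) (hσ σ h1).1 (hσ σ h1).2)
          have h2 : HasDerivAt (fun σ => ((z, t), σ - t))
              ((0 : Birkhoff.Phase n × ℝ), (1 : ℝ)) σ :=
            (hasDerivAt_const _ _).prodMk ((hasDerivAt_id σ).sub_const t)
          exact hsm.differentiableAt.hasFDerivAt.comp_hasDerivAt σ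
            (f := fun σ => ((z, t), σ - t)) h2)
        (fun σ h1 => (hball _ (hx z hz (σ - t) (hσ σ h1).1 (hσ σ h1).2)).2.2.1)
        (fun σ h1 => by
          have h2 := (hball _ (hx z hz (σ - t) (hσ σ h1).1 (hσ σ h1).2)).2.2.2.2
          simp only [add_sub_cancel] at h2
          refine h2.trans ?_
          rw [norm_pow, Real.norm_eq_abs, abs_of_nonneg (hσ σ h1).1]
          exact mul_le_mul_of_nonneg_left (pow_le_pow_left₀ (hσ σ h1).1 (hσ σ h1).2 m) hC0.le)
      simp only [add_sub_cancel_left] at hfin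
      calc ‖g ((z, t), τ) - y (t + τ)‖ ≤ L * (C * τ ^ m) * τ := hfin
        _ = L * C * τ ^ (m + 1) := by ring
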